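/- Let $G$ be a finite group. A Carter subgroup of a group is a nilpotent subgroup that equals its own normalizer. For subgroups $H, A, B$ of $G$ with $B \trianglelefteq A$, let $\mathrm{Aut}_H(A/B)$ denote the image in $\mathrm{Aut}(A/B)$ of $N_H(A)\cap N_H(B)$ acting by conjugation. A finite group $X$ is said to satisfy $(*)$ if for every non-abelian composition factor $S=A/B$ of $X$ (where $B\trianglelefteq A$ are consecutive terms of any composition series of $X$) and every nilpotent subgroup $N$ of $X$, any two Carter subgroups of $\langle \mathrm{Aut}_N(S), S\rangle \le \mathrm{Aut}(S)$ are conjugate in that group (which is regarded as true if there are none); here $S$ is identified with its group of inner automorphisms. Let $K$ be a Carter subgroup of $G$ with center $Z(K)$, let $1\neq z\in Z(K)$, and assume that the centralizer $C_G(z)$ satisfies $(*)$. Then: (1) every subgroup $Y$ of $G$ that contains $K$ and satisfies $(*)$ is self-normalizing in $G$; (2) no conjugate of $z$ in $G$, except $z$ itself, lies in $Z(K)$; (3) if $H$ is a Carter subgroup of $G$ that is not conjugate to $K$ in $G$, then $z$ is not conjugate in $G$ to any element of the center of $H$. In particular, $C_G(z)$ is self-normalizing in $G$, and $z$ is not conjugate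 in $G$ to any power $z^k\neq z$ ($k\in\mathbb Z$). -/

import Mathlib

/-- Two subgroups of a group are conjugate. -/
def SubgroupsConj {G : Type*} [Group G] (H K : Subgroup G) : Prop :=
  ∃ g : G, K = H.map (MulAut.conj g).toMonoidHom

/-- A subgroup that equals its normalizer. -/
def IsSelfNormalizing {G : Type*} [Group G] (H : Subgroup G) : Prop :=
  Subgroup.normalizer (H : Set G) = H

/-- A Carter subgroup: a nilpotent self-normalizing subgroup. -/
def IsCarter {G : Type*} [Group G] (K : Subgroup G) : Prop :=
  Group.IsNilpotent K ∧ IsSelfNormalizing K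

/-- The Carter subgroups of `G` are conjugate (vacuously so if there are none). -/
def CarterSubgroupsConj (G : Type*) [Group G] : Prop :=
  ∀ H K : Subgroup G, IsCarter H → IsCarter K → SubgroupsConj H K

/-- One step `B ⊲ A` of a composition series: `B` is normal in `A` and `A / B` is simple. -/
def IsCompositionStep {G : Type*} [Group G] (B A : Subgroup G) : Prop :=
  B ≤ A ∧ ∃ _ : (B.subgroupOf A).Normal, IsSimpleGroup (A ⧸ B.subgroupOf A)

/-- `A / B` is a composition factor of `G`: there is a composition series
`1 = G₀ ⊲ ⋯ ⊲ B ⊲ A ⊲ ⋯ ⊲ Gₙ = G` in which `B` and `A` are consecutive terms. -/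
def IsCompositionFactor {G : Type*} [Group G] (A B : Subgroup G) : Prop :=
  Relation.ReflTransGen IsCompositionStep ⊥ B ∧ IsCompositionStep B A ∧
    Relation.ReflTransGen IsCompositionStep A ⊤

/-- `N_H(A/B) = N_H(A) ∩ N_H(B)`. -/
def sectionNormalizer {G : Type*} [Group G] (H A B : Subgroup G) : Subgroup G :=
  H ⊓ (Subgroup.normalizer (A : Set G) ⊓ Subgroup.normalizer (B : Set G))

/-- The homomorphism `N_H(A/B) → Aut(A)` given by conjugation. -/
def sectionConj {G : Type*} [Group G] (H A B : Subgroup G) :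
    sectionNormalizer H A B →* MulAut A :=
  A.normalizerMonoidHom.comp
    (Subgroup.inclusion (inf_le_right.trans inf_le_left :
      sectionNormalizer H A B ≤ Subgroup.normalizer (A : Set G)))

theorem sectionConj_coe {G : Type*} [Group G] (H A B : Subgroup G)
    (x : sectionNormalizer H A B) (a : A) :
    ((sectionConj H A B x a : A) : G) = (x : G) * (a : G) * (x : G)⁻¹ := rfl

theorem sectionConj_map {G : Type*} [Group G] (H A B : Subgroup G)
    (x : sectionNormalizer H A B) :
    (B.subgroupOf A).map (sectionConj H A B x : A →* A) = B.subgroupOf A := by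
  have key : ∀ y : sectionNormalizer H A B, ∀ a : A, (a : G) ∈ B →
      ((sectionConj H A B y a : A) : G) ∈ B := fun y a ha =>
    (Subgroup.mem_normalizer_iff.mp y.2.2.2 (a : G)).mp ha
  ext a
  constructor
  · rintro ⟨b, hb, rfl⟩
    exact key x b hb
  · intro ha
    refine ⟨sectionConj H A B x⁻¹ a, key x⁻¹ a ha, ?_⟩
    apply Subtype.ext
    simp

/-- The homomorphism `N_H(A/B) → Aut(A/B)`, sending `x` to the automorphism of `A/B`
induced by conjugation by `x`. -/
def sectionHom {G : Type*} [Group G] (H A B : Subgroup G) [(B.subgroupOf A).Normal] :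
    sectionNormalizer H A B →* MulAut (A ⧸ B.subgroupOf A) where
  toFun x := QuotientGroup.congr (B.subgroupOf A) (B.subgroupOf A) (sectionConj H A B x)
    (sectionConj_map H A B x)
  map_one' := by
    ext q
    induction q using QuotientGroup.induction_on with
    | H a => simp
  map_mul' x y := by
    ext q
    induction q using QuotientGroup.induction_on with
    | H a => simp

/-- The group of induced automorphisms `Aut_H(A/B)`. -/
def inducedAut {G : Type*} [Group G] (H A B : Subgroup G) [(B.subgroupOf A).Normal] :
    Subgroup (MulAut (A ⧸ B.subgroupOf A)) :=
  (sectionHom H A B).range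

/-- Condition `(*)`: for every non-abelian composition factor `S = A/B` of `G` and every
nilpotent subgroup `N` of `G`, the Carter subgroups of `⟨Aut_N(S), S⟩ ≤ Aut(S)` are
conjugate. Here `S`, having trivial center, is identified with its group of inner
automorphisms. -/
def SatisfiesStar (G : Type*) [Group G] : Prop :=
  ∀ (A B : Subgroup G) [(B.subgroupOf A).Normal], IsCompositionFactor A B →
    (¬ ∀ s t : A ⧸ B.subgroupOf A, s * t = t * s) →
    ∀ N : Subgroup G, Group.IsNilpotent N →
      CarterSubgroupsConj
        ↥(inducedAut N A B ⊔ (MulAut.conj : (A ⧸ B.subgroupOf A) →* _).range)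

/-- The center `Z(K)` of a subgroup `K` of `G`, as a subgroup of `G`. -/
def centerIn {G : Type*} [Group G] (K : Subgroup G) : Subgroup G :=
  (Subgroup.center K).map K.subtype

/-! Everything rests on one fact, `SatisfiesStar.carterSubgroupsConj`: in a finite group with (*)
the Carter subgroups are conjugate. Given it, (1) is the Frattini argument. If g carries z into
Z(H), then K and g⁻¹Hg are Carter subgroups of C_G(z), hence conjugate there by some c, and H =
(gc)K(gc)⁻¹. This is (3); for H = K it gives gc ∈ N_G(K) = K, so gc and c commute with z, hence so
does g, which is (2). The last two claims are instances of (1) and (2).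

The fact is proved by induction on |G|. To let the induction run, (*) is replaced by `StarRel G N`,
which sees only subnormal sections of a normal subgroup N with G/N solvable. For a minimal normal
subgroup V of G inside N and a Carter subgroup H, this passes to G/V with N/V, and to HV with V in
place of N, HV/V being nilpotent. Induction leaves the case HV = KV = G.

If V is abelian, it is a p-group, and unless G is nilpotent H and K are normalizers of Sylow
q-subgroups for some q ≠ p. If V is nonabelian, it is generated by its minimal normal subgroups U,
which are simple and commute pairwise. The crux, `IsCarter.mem_autPreimage_of_mem_normalizer`, makes
Aut_H(U) a Carter subgroup of N_G(U)/C_G(U). By hypothesis Aut_H(U) and Aut_K(U) are then conjugate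
under U. Components in the various U being independent, one conjugation of H makes them equal for
all U at once. Then K lies in HD, where D = `autCore V H` is nilpotent and normalized by H. As HD is
solvable, H and K are conjugate in it. -/

namespace Subgroup

/-! ### Conjugates of subgroups. -/

variable {G : Type*} [Group G]

/-- The conjugate `g H g⁻¹`. -/
def cj (g : G) (H : Subgroup G) : Subgroup G := H.map (MulAut.conj g).toMonoidHom

theorem mem_cj {g x : G} {H : Subgroup G} : x ∈ cj g H ↔ g⁻¹ * x * g ∈ H := by
  unfold cj
  rw [mem_map]
  constructor
  · rintro ⟨y, hy, rfl⟩
    simpa [mul_assoc] using hy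
  · intro h
    exact ⟨_, h, by simp [mul_assoc]⟩

theorem conj_mem_cj {g x : G} {H : Subgroup G} : g * x * g⁻¹ ∈ cj g H ↔ x ∈ H := by
  rw [mem_cj]; simp [mul_assoc]

theorem cj_mul (a b : G) (H : Subgroup G) : cj (a * b) H = cj a (cj b H) := by
  ext x; simp [mem_cj, mul_assoc]

@[simp] theorem cj_one (H : Subgroup G) : cj 1 H = H := by
  ext x; simp [mem_cj]

@[simp] theorem cj_inv_cj (a : G) (H : Subgroup G) : cj a⁻¹ (cj a H) = H := by
  rw [← cj_mul]; simp

@[simp] theorem cj_cj_inv (a : G) (H : Subgroup G) : cj a (cj a⁻¹ H) = H := by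
  rw [← cj_mul]; simp

theorem cj_mono {a : G} {H K : Subgroup G} (h : H ≤ K) : cj a H ≤ cj a K := map_mono h

theorem cj_le_cj {a : G} {H K : Subgroup G} : cj a H ≤ cj a K ↔ H ≤ K :=
  ⟨fun h => by simpa using cj_mono (a := a⁻¹) h, cj_mono⟩

theorem cj_sup (a : G) (H K : Subgroup G) : cj a (H ⊔ K) = cj a H ⊔ cj a K := map_sup _ _ _

theorem cj_inf (a : G) (H K : Subgroup G) : cj a (H ⊓ K) = cj a H ⊓ cj a K := by
  ext; simp [mem_cj]

theorem cj_eq_self_iff {g : G} {H : Subgroup G} :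
    cj g H = H ↔ g ∈ normalizer (H : Set G) := by
  rw [mem_normalizer_iff'', SetLike.ext_iff]
  exact forall_congr' fun x => by rw [mem_cj]; exact iff_comm

theorem cj_eq_of_mem {g : G} {H : Subgroup G} (h : g ∈ H) : cj g H = H :=
  cj_eq_self_iff.2 (le_normalizer h)

theorem cj_of_normal (g : G) (H : Subgroup G) [hH : H.Normal] : cj g H = H :=
  cj_eq_self_iff.2 (by rw [normalizer_eq_top]; trivial)

theorem normal_of_cj_eq {H : Subgroup G} (h : ∀ g, cj g H = H) : H.Normal := by
  rw [← normalizer_eq_top_iff, eq_top_iff]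
  exact fun g _ => cj_eq_self_iff.1 (h g)

theorem card_cj (g : G) (H : Subgroup G) : Nat.card (cj g H) = Nat.card H :=
  Nat.card_congr (H.equivMapOfInjective _ (MulAut.conj g).injective).toEquiv.symm

theorem cj_eq_of_le [Finite G] {g : G} {H : Subgroup G} (h : cj g H ≤ H) : cj g H = H :=
  eq_of_le_of_card_ge h (card_cj g H).ge

/-- In a finite group it suffices to check one inclusion for normalizing. -/
theorem mem_normalizer_of_conj_mem [Finite G] {g : G} {H : Subgroup G}
    (h : ∀ x ∈ H, g * x * g⁻¹ ∈ H) : g ∈ normalizer (H : Set G) := by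
  refine cj_eq_self_iff.1 (cj_eq_of_le fun x hx => ?_)
  simpa [mul_assoc] using h _ (mem_cj.1 hx)

theorem cj_normalizer (g : G) (H : Subgroup G) :
    cj g (normalizer (H : Set G)) = normalizer (cj g H : Set G) := by
  ext x
  rw [mem_cj, ← cj_eq_self_iff, ← cj_eq_self_iff, cj_mul, cj_mul]
  constructor
  · intro h
    have := congrArg (cj g) h
    simpa using this
  · intro h
    rw [h]; simp

theorem cj_centralizer (g : G) (H : Subgroup G) :
    cj g (centralizer (H : Set G)) = centralizer (cj g H : Set G) := by
  ext x
  rw [mem_cj, mem_centralizer_iff, mem_centralizer_iff]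
  constructor
  · intro h y hy
    have := h _ (mem_cj.1 hy)
    have := congrArg (fun t => g * t * g⁻¹) this
    simpa [mul_assoc] using this
  · intro h y hy
    have := h _ (conj_mem_cj.2 hy)
    have := congrArg (fun t => g⁻¹ * t * g) this
    simpa [mul_assoc] using this

theorem map_cj {G' : Type*} [Group G'] (f : G →* G') (g : G) (H : Subgroup G) :
    (cj g H).map f = cj (f g) (H.map f) := by
  unfold cj
  rw [map_map, map_map]
  congr 1
  ext; simp

theorem map_subtype_cj {W : Subgroup G} (w : W) (H : Subgroup W) :
    (cj w H).map W.subtype = cj (w : G) (H.map W.subtype) := map_cj _ _ _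

theorem mem_sup_of_le_normalizer {H N : Subgroup G} (h : H ≤ normalizer (N : Set G)) {x : G} :
    x ∈ H ⊔ N ↔ ∃ a ∈ H, ∃ b ∈ N, a * b = x := by
  rw [← SetLike.mem_coe, coe_mul_of_left_le_normalizer_right H N h]
  exact Set.mem_mul

theorem mem_sup_of_normal {H N : Subgroup G} [N.Normal] {x : G} :
    x ∈ H ⊔ N ↔ ∃ a ∈ H, ∃ b ∈ N, a * b = x :=
  mem_sup_of_le_normalizer le_normalizer_of_normal

end Subgroup

open Subgroup

/-! ### Carter subgroups, subgroups and quotients. -/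

section Carter

variable {G : Type*} [Group G]

theorem subgroupsConj_iff {H K : Subgroup G} : SubgroupsConj H K ↔ ∃ g, K = cj g H := Iff.rfl

theorem SubgroupsConj.symm {H K : Subgroup G} (h : SubgroupsConj H K) : SubgroupsConj K H := by
  obtain ⟨g, rfl⟩ := subgroupsConj_iff.1 h
  exact subgroupsConj_iff.2 ⟨g⁻¹, by simp⟩

theorem IsCarter.mem_of_cj_eq {H : Subgroup G} (hH : IsCarter H) {g : G} (h : cj g H = H) :
    g ∈ H := by
  have := cj_eq_self_iff.1 h
  rwa [hH.2] at this

theorem isNilpotent_cj {H : Subgroup G} (hH : Group.IsNilpotent H) (g : G) :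
    Group.IsNilpotent (cj g H) :=
  Group.nilpotent_of_mulEquiv (H.equivMapOfInjective _ (MulAut.conj g).injective)

theorem IsCarter.conjugate {H : Subgroup G} (hH : IsCarter H) (g : G) : IsCarter (cj g H) := by
  refine ⟨isNilpotent_cj hH.1 g, ?_⟩
  unfold IsSelfNormalizing
  rw [← cj_normalizer, hH.2]

theorem isNilpotent_subgroupOf {H W : Subgroup G} (h : H ≤ W) (hH : Group.IsNilpotent H) :
    Group.IsNilpotent (H.subgroupOf W) :=
  Group.nilpotent_of_mulEquiv (subgroupOfEquivOfLe h).symm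

theorem IsCarter.subgroupOf {H W : Subgroup G} (hH : IsCarter H) (h : H ≤ W) :
    IsCarter (H.subgroupOf W) := by
  refine ⟨isNilpotent_subgroupOf h hH.1, ?_⟩
  unfold IsSelfNormalizing
  rw [← subgroupOf_normalizer_eq h, hH.2]

theorem CarterSubgroupsConj.exists_mem {W H K : Subgroup G} (hW : CarterSubgroupsConj W)
    (hH : IsCarter H) (hK : IsCarter K) (hHW : H ≤ W) (hKW : K ≤ W) : ∃ w ∈ W, K = cj w H := by
  obtain ⟨w, hw⟩ := subgroupsConj_iff.1 (hW _ _ (hH.subgroupOf hHW) (hK.subgroupOf hKW))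
  refine ⟨w, w.2, ?_⟩
  have := congrArg (Subgroup.map W.subtype) hw
  rwa [map_subtype_cj, subgroupOf_map_subtype, subgroupOf_map_subtype, inf_eq_left.2 hKW,
    inf_eq_left.2 hHW] at this

/-- The Frattini argument for Carter subgroups. -/
theorem IsCarter.mem_of_cj_le {W H : Subgroup G} (hW : CarterSubgroupsConj W)
    (hH : IsCarter H) (hHW : H ≤ W) {y : G} (hy : cj y H ≤ W) : y ∈ W := by
  obtain ⟨w, hw, he⟩ := hW.exists_mem hH (hH.conjugate y) hHW hy
  -- Both H and its y-conjugate are Carter in W, so some w ∈ W corrects y to an element of N(H) = H.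
  have : cj (w⁻¹ * y) H = H := by rw [cj_mul, he]; simp
  have := hHW (hH.mem_of_cj_eq this)
  simpa using W.mul_mem hw this

theorem IsCarter.eq_top_of_isNilpotent [Group.IsNilpotent G] {H : Subgroup G} (hH : IsCarter H) :
    H = ⊤ := by
  by_contra h
  have := Group.normalizerCondition_of_isNilpotent (G := G) H (lt_top_iff_ne_top.2 h)
  rw [hH.2] at this
  exact lt_irrefl _ this

theorem isNilpotent_map {G' : Type*} [Group G'] (f : G →* G') {H : Subgroup G}
    (hH : Group.IsNilpotent H) : Group.IsNilpotent (H.map f) :=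
  Group.nilpotent_of_surjective (f.subgroupMap H) (f.subgroupMap_surjective H)

/-- An element normalizing HV/V conjugates H into HV, so the Frattini argument in HV puts it in HV.
When HV = G there is nothing to prove, which is why conjugacy is demanded only for proper HV;
inductions on |G| need exactly this. -/
theorem IsCarter.map_mk {H : Subgroup G} (hH : IsCarter H) (V : Subgroup G) [V.Normal]
    (h : H ⊔ V ≠ ⊤ → CarterSubgroupsConj ↥(H ⊔ V)) :
    IsCarter (H.map (QuotientGroup.mk' V)) := by
  refine ⟨isNilpotent_map _ hH.1, le_antisymm ?_ le_normalizer⟩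
  have hc : (H.map (QuotientGroup.mk' V)).comap (QuotientGroup.mk' V) = H ⊔ V := by
    rw [comap_map_eq, QuotientGroup.ker_mk']
  intro x hx
  obtain ⟨x, rfl⟩ := QuotientGroup.mk'_surjective V x
  rw [← mem_comap, hc]
  by_cases ht : H ⊔ V = ⊤
  · rw [ht]; trivial
  · refine hH.mem_of_cj_le (h ht) le_sup_left ?_
    rw [← hc, ← map_le_iff_le_comap, map_cj, cj_eq_self_iff.2 hx]

/-- Conjugacy in G/V moves HV onto KV. If KV is proper, conjugacy of Carter subgroups inside it
finishes; the remaining case is that V supplements both. -/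
theorem carter_conj_or_sup_eq_top (V : Subgroup G) [V.Normal] {H K : Subgroup G}
    (hH : IsCarter H) (hK : IsCarter K)
    (hHV : H ⊔ V ≠ ⊤ → CarterSubgroupsConj ↥(H ⊔ V))
    (hKV : K ⊔ V ≠ ⊤ → CarterSubgroupsConj ↥(K ⊔ V))
    (hQ : CarterSubgroupsConj (G ⧸ V)) :
    SubgroupsConj H K ∨ (H ⊔ V = ⊤ ∧ K ⊔ V = ⊤) := by
  obtain ⟨q, hq⟩ := subgroupsConj_iff.1 (hQ _ _ (hH.map_mk V hHV) (hK.map_mk V hKV))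
  obtain ⟨g, rfl⟩ := QuotientGroup.mk'_surjective V q
  rw [← map_cj] at hq
  have h1 := congrArg (Subgroup.comap (QuotientGroup.mk' V)) hq
  rw [comap_map_eq, comap_map_eq, QuotientGroup.ker_mk'] at h1
  by_cases ht : K ⊔ V = ⊤
  · right
    refine ⟨?_, ht⟩
    rw [ht, ← cj_of_normal g V, ← cj_sup] at h1
    rw [eq_top_iff, ← cj_le_cj (a := g), ← h1]
    exact le_top
  · left
    obtain ⟨w, -, hw⟩ := (hKV ht).exists_mem (hH.conjugate g) hK (h1 ▸ le_sup_left) le_sup_left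
    exact subgroupsConj_iff.2 ⟨w * g, by rw [cj_mul, hw]⟩

end Carter

/-! ### Abelian minimal normal subgroups. -/

section Minimal

variable {G : Type*} [Group G]

/-- `V` is minimal among the nontrivial subgroups normalized by `L`. -/
def IsMinNormalizedBy (L V : Subgroup G) : Prop :=
  V ≠ ⊥ ∧ L ≤ normalizer (V : Set G) ∧
    ∀ W : Subgroup G, W ≤ V → L ≤ normalizer (W : Set G) → W = ⊥ ∨ W = V

theorem exists_isMinNormalizedBy_le [Finite G] {L N : Subgroup G} (hN : N ≠ ⊥)
    (hL : L ≤ normalizer (N : Set G)) : ∃ V ≤ N, IsMinNormalizedBy L V := by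
  obtain ⟨V, hVN, hV⟩ := exists_minimal_le_of_wellFoundedLT
    (fun V : Subgroup G => V ≠ ⊥ ∧ L ≤ normalizer (V : Set G)) N ⟨hN, hL⟩
  refine ⟨V, hVN, hV.1.1, hV.1.2, fun W hW hLW => ?_⟩
  by_cases h : W = ⊥
  · exact Or.inl h
  · exact Or.inr (le_antisymm hW (hV.2 ⟨h, hLW⟩ hW))

theorem IsMinNormalizedBy.normal {V : Subgroup G} (h : IsMinNormalizedBy ⊤ V) : V.Normal :=
  normalizer_eq_top_iff.1 (top_le_iff.1 h.2.1)

theorem IsMinNormalizedBy.eq_bot_or_eq {V W : Subgroup G} (h : IsMinNormalizedBy ⊤ V)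
    (hW : W.Normal) (hWV : W ≤ V) : W = ⊥ ∨ W = V :=
  h.2.2 W hWV (normalizer_eq_top_iff.2 hW).ge

/-- For a prime p dividing |V|, the elements of V killed by p form a nontrivial normal subgroup of
G, hence all of V. -/
theorem IsMinNormalizedBy.exists_isPGroup [Finite G] {V : Subgroup G}
    (h : IsMinNormalizedBy ⊤ V) (hc : ∀ a ∈ V, ∀ b ∈ V, a * b = b * a) :
    ∃ p, p.Prime ∧ IsPGroup p V := by
  have hV := h.normal
  have h1 : Nat.card V ≠ 1 := fun e => h.1 (eq_bot_of_card_eq V e)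
  have hp := Nat.minFac_prime h1
  set p := (Nat.card V).minFac
  have : Fact p.Prime := ⟨hp⟩
  obtain ⟨x, hx⟩ := exists_prime_orderOf_dvd_card' p (Nat.minFac_dvd (Nat.card V))
  let W : Subgroup G :=
    { carrier := {v | v ∈ V ∧ v ^ p = 1}
      one_mem' := ⟨V.one_mem, one_pow _⟩
      mul_mem' := fun {a b} ha hb => ⟨V.mul_mem ha.1 hb.1, by
        have : Commute a b := hc a ha.1 b hb.1
        rw [this.mul_pow, ha.2, hb.2, one_mul]⟩
      inv_mem' := fun {a} ha => ⟨V.inv_mem ha.1, by rw [inv_pow, ha.2, inv_one]⟩ }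
  have hWn : W.Normal := ⟨fun v hv g => ⟨hV.conj_mem v hv.1 g, by
    rw [conj_pow, hv.2]; simp⟩⟩
  have hxW : (x : G) ∈ W := ⟨x.2, by
    rw [← hx, ← Subgroup.orderOf_coe]; exact pow_orderOf_eq_one _⟩
  refine ⟨p, hp, ?_⟩
  rcases h.eq_bot_or_eq hWn (fun v hv => hv.1) with e | e
  · rw [e, mem_bot] at hxW
    rw [← Subgroup.orderOf_coe, hxW, orderOf_one] at hx
    exact absurd hx.symm hp.one_lt.ne'
  · intro v
    have : (v : G) ∈ W := by rw [e]; exact v.2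
    exact ⟨1, by rw [pow_one]; exact Subtype.ext this.2⟩

/-- A supplement of an abelian minimal normal subgroup is a maximal subgroup. -/
theorem eq_or_eq_top_of_sup_eq_top {V : Subgroup G} (h : IsMinNormalizedBy ⊤ V)
    (hc : ∀ a ∈ V, ∀ b ∈ V, a * b = b * a) {H L : Subgroup G} (hHV : H ⊔ V = ⊤) (hHL : H ≤ L) :
    L = H ∨ L = ⊤ := by
  have hV := h.normal
  -- L normalizes L ∩ V and the abelian V centralizes it; since H ≤ L, these two generate G.
  have hn : (L ⊓ V).Normal := by
    rw [← normalizer_eq_top_iff, eq_top_iff, ← hHV]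
    refine sup_le (hHL.trans ?_) fun v hv => ?_
    · refine le_normalizer_iff.2 fun l hl k hk => ⟨?_, hV.conj_mem _ hk.2 _⟩
      exact L.mul_mem (L.mul_mem hl hk.1) (L.inv_mem hl)
    · rw [mem_normalizer_iff]
      intro x
      constructor
      · rintro ⟨h1, h2⟩
        rw [hc v hv x h2, mul_inv_cancel_right]
        exact ⟨h1, h2⟩
      · intro hx
        have h2 : x ∈ V := by
          simpa [mul_assoc] using hV.conj_mem _ hx.2 v⁻¹
        rwa [hc v hv x h2, mul_inv_cancel_right] at hx
  rcases h.eq_bot_or_eq hn inf_le_right with e | e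
  · left
    refine le_antisymm (fun l hl => ?_) hHL
    obtain ⟨a, ha, b, hb, rfl⟩ := mem_sup_of_normal.1 (hHV ▸ mem_top l : l ∈ H ⊔ V)
    have : b ∈ L ⊓ V := ⟨by simpa using L.mul_mem (L.inv_mem (hHL ha)) hl, hb⟩
    rw [e, mem_bot] at this
    rwa [this, mul_one]
  · right
    rw [eq_top_iff, ← hHV]
    exact sup_le hHL (e ▸ inf_le_left)

theorem index_dvd_card_of_sup_eq_top [Finite G] {H V : Subgroup G} [V.Normal] (h : H ⊔ V = ⊤) :
    H.index ∣ Nat.card V := by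
  have h1 : V.index ∣ Nat.card H := by
    rw [← relIndex_top_right, ← h, relIndex_sup_right]
    exact relIndex_dvd_card _ _
  obtain ⟨k, hk⟩ := h1
  have h2 : Nat.card V * V.index = Nat.card H * H.index := by
    rw [card_mul_index, card_mul_index]
  rw [hk, mul_comm, mul_assoc] at h2
  refine ⟨k, ?_⟩
  rw [mul_comm H.index]
  exact Nat.eq_of_mul_eq_mul_left (Nat.pos_of_ne_zero FiniteIndex.index_ne_zero) h2

theorem isNilpotent_quotient_of_sup_eq_top {H V : Subgroup G} [V.Normal]
    (hH : Group.IsNilpotent H) (h : H ⊔ V = ⊤) : Group.IsNilpotent (G ⧸ V) := by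
  refine Group.nilpotent_of_surjective ((QuotientGroup.mk' V).comp H.subtype) fun q => ?_
  obtain ⟨g, rfl⟩ := QuotientGroup.mk'_surjective V q
  obtain ⟨a, ha, b, hb, rfl⟩ := mem_sup_of_normal.1 (h ▸ mem_top g : g ∈ H ⊔ V)
  refine ⟨⟨a, ha⟩, ?_⟩
  simpa [QuotientGroup.eq] using hb

/-- Sylow subgroups are normal as soon as they are so modulo a normal `p`-subgroup. -/
theorem Sylow.normal_of_isNilpotent_quotient [Finite G] {p : ℕ} [Fact p.Prime] {V : Subgroup G}
    [V.Normal] (hV : IsPGroup p V) [Group.IsNilpotent (G ⧸ V)] (P : Sylow p G) :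
    (P : Subgroup G).Normal := by
  have hs := QuotientGroup.mk'_surjective V
  have hn : ((P.mapSurjective hs : Sylow p (G ⧸ V)) : Subgroup (G ⧸ V)).Normal := inferInstance
  have hc := hn.comap (QuotientGroup.mk' V)
  rw [Sylow.coe_mapSurjective, comap_map_eq, QuotientGroup.ker_mk',
    sup_eq_left.2 (hV.le_sylow_of_normal P)] at hc
  exact hc

/-- If G is not nilpotent, some Sylow q-subgroup is not normal, and q differs from the prime p of V
because G/V is nilpotent. The index of H is a power of p, so H contains a Sylow q-subgroup S of G,
normal in the nilpotent H. As H is maximal and N(S) ≠ G, H = N(S). The same holds for K, and Sylow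
subgroups are conjugate. -/
theorem carter_conj_of_sup_eq_top_of_comm [Finite G] {V : Subgroup G}
    (h : IsMinNormalizedBy ⊤ V) (hc : ∀ a ∈ V, ∀ b ∈ V, a * b = b * a) {H K : Subgroup G}
    (hH : IsCarter H) (hK : IsCarter K) (hHV : H ⊔ V = ⊤) (hKV : K ⊔ V = ⊤) :
    SubgroupsConj H K := by
  have hV := h.normal
  by_cases hn : Group.IsNilpotent G
  · rw [hH.eq_top_of_isNilpotent, hK.eq_top_of_isNilpotent]
    exact subgroupsConj_iff.2 ⟨1, by simp⟩
  have hs : Group.IsNilpotent G ↔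
      ∀ (p : ℕ) (_ : Fact p.Prime) (P : Sylow p G), (P : Subgroup G).Normal :=
    (Group.isNilpotent_of_finite_tfae (G := G)).out 0 3
  rw [hs] at hn
  push Not at hn
  obtain ⟨q, hq, Q, hQ⟩ := hn
  obtain ⟨p, hp, hVp⟩ := h.exists_isPGroup hc
  have := Fact.mk hp
  have hpq : q ≠ p := by
    rintro rfl
    have := isNilpotent_quotient_of_sup_eq_top hH.1 hHV
    exact hQ (Sylow.normal_of_isNilpotent_quotient hVp Q)
  have key : ∀ X : Subgroup G, IsCarter X → X ⊔ V = ⊤ →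
      ∃ S : Sylow q G, X ≤ normalizer ((S : Subgroup G) : Set G) := by
    intro X hX hXV
    obtain ⟨S⟩ : Nonempty (Sylow q X) := inferInstance
    have hSn : (S : Subgroup X).Normal := by
      have := hX.1
      infer_instance
    have hi : ¬ q ∣ ((S : Subgroup X).map X.subtype).index := by
      rw [index_map_subtype]
      intro hd
      rcases hq.out.dvd_mul.1 hd with hd | hd
      · exact S.not_dvd_index hd
      · obtain ⟨n, hn⟩ := IsPGroup.iff_card.1 hVp
        have := hd.trans (index_dvd_card_of_sup_eq_top hXV)
        rw [hn] at this
        exact hpq ((Nat.prime_dvd_prime_iff_eq hq.out hp).1 (hq.out.dvd_of_dvd_pow this))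
    refine ⟨(S.2.map X.subtype).toSylow hi, ?_⟩
    rw [IsPGroup.toSylow_coe, le_normalizer_iff]
    rintro x hx _ ⟨s, hs, rfl⟩
    exact ⟨⟨x, hx⟩ * s * ⟨x, hx⟩⁻¹, hSn.conj_mem s hs _, rfl⟩
  obtain ⟨S, hS⟩ := key H hH hHV
  obtain ⟨T, hT⟩ := key K hK hKV
  obtain ⟨g, hg⟩ := MulAction.exists_smul_eq G T S
  have hSne : normalizer ((S : Subgroup G) : Set G) ≠ ⊤ := by
    intro e
    rw [normalizer_eq_top_iff] at e
    obtain ⟨x, hx⟩ := MulAction.exists_smul_eq G S Q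
    rw [Sylow.smul_eq_of_normal] at hx
    exact hQ (hx ▸ e)
  have hTS : cj g (T : Subgroup G) = S := by
    rw [← hg]; rfl
  have hKS : cj g K ≤ normalizer ((S : Subgroup G) : Set G) := by
    rw [← hTS, ← cj_normalizer]
    exact cj_mono hT
  have hKV' : cj g K ⊔ V = ⊤ := by
    rw [← cj_of_normal g V, ← cj_sup, hKV]
    exact cj_eq_of_mem (mem_top g)
  have e1 := (eq_or_eq_top_of_sup_eq_top h hc hHV hS).resolve_right hSne
  have e2 := (eq_or_eq_top_of_sup_eq_top h hc hKV' hKS).resolve_right hSne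
  exact SubgroupsConj.symm (subgroupsConj_iff.2 ⟨g, e1 ▸ e2⟩)

end Minimal

/-! ### The solvable case. -/

theorem carterSubgroupsConj_of_subsingleton {G : Type*} [Group G] [Subsingleton G] :
    CarterSubgroupsConj G :=
  fun _ _ _ _ => subgroupsConj_iff.2 ⟨1, Subsingleton.elim _ _⟩

theorem card_lt_of_ne_top {G : Type*} [Group G] [Finite G] {W : Subgroup G} (h : W ≠ ⊤) :
    Nat.card W < Nat.card G :=
  lt_of_le_of_ne (Nat.le_of_dvd Nat.card_pos W.card_subgroup_dvd_card)
    fun e => h (card_eq_iff_eq_top W |>.1 e)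

theorem card_quotient_lt {G : Type*} [Group G] [Finite G] {V : Subgroup G} (h : V ≠ ⊥) :
    Nat.card (G ⧸ V) < Nat.card G := by
  rw [V.card_eq_card_quotient_mul_card_subgroup]
  exact lt_mul_of_one_lt_right Nat.card_pos (V.one_lt_card_iff_ne_bot.2 h)

/-- Carter subgroups of a finite solvable group are conjugate. -/
theorem carterSubgroupsConj_of_isSolvable (G : Type*) [Group G] [Finite G]
    [hG : Group.IsSolvable G] : CarterSubgroupsConj G := by
  induction hn : Nat.card G using Nat.strong_induction_on generalizing G with
  | _ n ih =>
  subst hn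
  rcases subsingleton_or_nontrivial G with hs | hs
  · exact carterSubgroupsConj_of_subsingleton
  obtain ⟨V, -, hV⟩ := exists_isMinNormalizedBy_le (G := G) (L := ⊤) (N := ⊤) top_ne_bot
    (by rw [normalizer_eq_top])
  have hVn := hV.normal
  have hc : ∀ a ∈ V, ∀ b ∈ V, a * b = b * a := by
    have hlt := Group.IsSolvable.commutator_lt_of_ne_bot hV.1
    have hb := (hV.eq_bot_or_eq (commutator_normal V V) hlt.le).resolve_right hlt.ne
    intro a ha b hb'
    have := commutator_mem_commutator ha hb'
    rw [hb, mem_bot, commutatorElement_eq_one_iff_mul_comm] at this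
    exact this
  intro H K hH hK
  rcases carter_conj_or_sup_eq_top V hH hK (fun h => ih _ (card_lt_of_ne_top h) _ rfl)
    (fun h => ih _ (card_lt_of_ne_top h) _ rfl) (ih _ (card_quotient_lt hV.1) _ rfl) with h | h
  · exact h
  · exact carter_conj_of_sup_eq_top_of_comm hV hc hH hK h.1 h.2

/-! ### Carter subgroups of sections, and the relative form of (*). -/

section Relative

variable {G : Type*} [Group G]

/-- `X / C` is a Carter subgroup of `L / C`, with `L` and `C` replaced by `L` and `C ⊓ L`. -/
structure RelCarter (L C X : Subgroup G) : Prop where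
  inf_le : C ⊓ L ≤ X
  le : X ≤ L
  nilp : ∃ n, X.lowerCentralSeries n ≤ C
  self : ∀ g ∈ L, g ∈ normalizer (X : Set G) → g ∈ X

/-- The Carter subgroups of `L / (C ⊓ L)` are conjugate. -/
def RelCarterConj (L C : Subgroup G) : Prop :=
  ∀ X Y, RelCarter L C X → RelCarter L C Y → ∃ g ∈ L, Y = cj g X

/-- Links the relative notion to actual Carter subgroups of Q ≅ L/(C ∩ L). Staying with subgroups of
G avoids quotient types when the ambient group changes. -/
theorem relCarterConj_of_surjective {L C : Subgroup G} {Q : Type*} [Group Q] (f : L →* Q)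
    (hf : Function.Surjective f) (hk : f.ker = C.subgroupOf L) (hQ : CarterSubgroupsConj Q) :
    RelCarterConj L C := by
  have hker : ∀ X, RelCarter L C X → f.ker ≤ X.subgroupOf L := by
    intro X hX x hx
    rw [hk] at hx
    exact hX.inf_le ⟨hx, x.2⟩
  have hback : ∀ X, RelCarter L C X → ((X.subgroupOf L).map f).comap f = X.subgroupOf L :=
    fun X hX => by rw [comap_map_eq, sup_eq_left.2 (hker X hX)]
  have key : ∀ X, RelCarter L C X → IsCarter ((X.subgroupOf L).map f) := by
    intro X hX
    constructor
    · obtain ⟨n, hn⟩ := hX.nilp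
      refine isNilpotent_of_lowerCentralSeries_eq_bot (n := n) ?_
      rw [← map_lowerCentralSeries, eq_bot_iff]
      rintro _ ⟨x, hx, rfl⟩
      rw [mem_bot, ← MonoidHom.mem_ker, hk, mem_subgroupOf]
      refine hn ?_
      have : L.subtype x ∈ ((X.subgroupOf L).lowerCentralSeries n).map L.subtype :=
        mem_map_of_mem _ hx
      rwa [map_lowerCentralSeries, subgroupOf_map_subtype, inf_eq_left.2 hX.le] at this
    · refine le_antisymm ?_ le_normalizer
      intro q hq
      obtain ⟨l, rfl⟩ := hf q
      have h1 : l ∈ normalizer ((X.subgroupOf L : Subgroup L) : Set L) := by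
        rw [← hback X hX, ← comap_normalizer_eq_of_surjective _ hf]
        exact hq
      rw [← subgroupOf_normalizer_eq hX.le] at h1
      exact mem_map_of_mem f (hX.self l l.2 h1)
  intro X Y hX hY
  obtain ⟨q, hq⟩ := subgroupsConj_iff.1 (hQ _ _ (key X hX) (key Y hY))
  obtain ⟨l, rfl⟩ := hf q
  rw [← map_cj] at hq
  have h1 := congrArg (Subgroup.comap f) hq
  have h2 : f.ker ≤ cj l (X.subgroupOf L) := by
    rw [← cj_of_normal l f.ker]
    exact cj_mono (hker X hX)
  rw [hback Y hY, comap_map_eq, sup_eq_left.2 h2] at h1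
  have h3 := congrArg (Subgroup.map L.subtype) h1
  rw [map_subtype_cj, subgroupOf_map_subtype, subgroupOf_map_subtype, inf_eq_left.2 hX.le,
    inf_eq_left.2 hY.le] at h3
  exact ⟨l, l.2, h3⟩

theorem RelCarterConj.of_comap {G' : Type*} [Group G'] {f : G →* G'}
    (hf : Function.Surjective f) {L C : Subgroup G'}
    (h : RelCarterConj (L.comap f) (C.comap f)) : RelCarterConj L C := by
  have key : ∀ X, RelCarter L C X → RelCarter (L.comap f) (C.comap f) (X.comap f) := by
    intro X hX
    refine ⟨fun x hx => hX.inf_le hx, comap_mono hX.le, ?_, ?_⟩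
    · obtain ⟨n, hn⟩ := hX.nilp
      refine ⟨n, ?_⟩
      rw [← map_le_iff_le_comap, map_lowerCentralSeries, map_comap_eq_self_of_surjective hf]
      exact hn
    · intro g hg hgn
      rw [← comap_normalizer_eq_of_surjective _ hf] at hgn
      exact hX.self _ hg hgn
  intro X Y hX hY
  obtain ⟨g, hg, e⟩ := h _ _ (key X hX) (key Y hY)
  refine ⟨f g, hg, ?_⟩
  have := congrArg (Subgroup.map f) e
  rwa [map_cj, map_comap_eq_self_of_surjective hf, map_comap_eq_self_of_surjective hf] at this

theorem mem_normalizer_map_iff {G' : Type*} [Group G'] {f : G →* G'}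
    (hf : Function.Injective f) {X : Subgroup G} {g : G} :
    f g ∈ normalizer (X.map f : Set G') ↔ g ∈ normalizer (X : Set G) := by
  rw [← cj_eq_self_iff, ← cj_eq_self_iff, ← map_cj]
  exact (map_injective hf).eq_iff

theorem RelCarterConj.of_map {G' : Type*} [Group G'] {f : G →* G'}
    (hf : Function.Injective f) {L : Subgroup G} {C : Subgroup G'}
    (h : RelCarterConj (L.map f) C) : RelCarterConj L (C.comap f) := by
  have key : ∀ X, RelCarter L (C.comap f) X → RelCarter (L.map f) C (X.map f) := by
    intro X hX
    refine ⟨?_, map_mono hX.le, ?_, ?_⟩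
    · rintro _ ⟨h1, l, hl, rfl⟩
      exact mem_map_of_mem f (hX.inf_le ⟨h1, hl⟩)
    · obtain ⟨n, hn⟩ := hX.nilp
      exact ⟨n, by rw [← map_lowerCentralSeries]; exact map_le_iff_le_comap.2 hn⟩
    · rintro _ ⟨g, hg, rfl⟩ hgn
      exact mem_map_of_mem f (hX.self g hg ((mem_normalizer_map_iff hf).1 hgn))
  intro X Y hX hY
  obtain ⟨_, ⟨g, hg, rfl⟩, e⟩ := h _ _ (key X hX) (key Y hY)
  rw [← map_cj] at e
  exact ⟨g, hg, map_injective hf e⟩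

/-- This is LC/C ≅ L/(L ∩ C): a subgroup X with C ≤ X ≤ LC is recovered as (X ∩ L)C. -/
theorem RelCarterConj.sup {L C : Subgroup G} (hLC : L ≤ normalizer (C : Set G))
    (h : RelCarterConj L C) : RelCarterConj (L ⊔ C) C := by
  have hback : ∀ X, RelCarter (L ⊔ C) C X → (X ⊓ L) ⊔ C = X := by
    intro X hX
    have hCX : C ≤ X := fun c hc => hX.inf_le ⟨hc, le_sup_right (a := L) hc⟩
    refine le_antisymm (sup_le inf_le_left hCX) fun x hx => ?_
    obtain ⟨l, hl, c, hc, rfl⟩ := (mem_sup_of_le_normalizer hLC).1 (hX.le hx)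
    refine mul_mem_sup ⟨?_, hl⟩ hc
    simpa using X.mul_mem hx (X.inv_mem (hCX hc))
  have key : ∀ X, RelCarter (L ⊔ C) C X → RelCarter L C (X ⊓ L) := by
    intro X hX
    refine ⟨fun x hx => ⟨hX.inf_le ⟨hx.1, le_sup_right (a := L) hx.1⟩, hx.2⟩, inf_le_right, ?_, ?_⟩
    · obtain ⟨n, hn⟩ := hX.nilp
      exact ⟨n, (lowerCentralSeries_mono n inf_le_left).trans hn⟩
    · intro g hg hgn
      refine ⟨hX.self g (le_sup_left (b := C) hg) ?_, hg⟩
      rw [← cj_eq_self_iff] at hgn ⊢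
      rw [← hback X hX, cj_sup, hgn, cj_eq_self_iff.2 (hLC hg)]
  intro X Y hX hY
  obtain ⟨g, hg, e⟩ := h _ _ (key X hX) (key Y hY)
  refine ⟨g, le_sup_left (b := C) hg, ?_⟩
  rw [← hback X hX, ← hback Y hY, e, cj_sup, cj_eq_self_iff.2 (hLC hg)]

/-- The centralizer of the section `A / B` in `N(A) ∩ N(B)`. -/
def secCent (A B : Subgroup G) : Subgroup G where
  carrier := {g | (g ∈ normalizer (A : Set G) ∧ g ∈ normalizer (B : Set G)) ∧
    ∀ a ∈ A, g * a * g⁻¹ * a⁻¹ ∈ B}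
  one_mem' := ⟨⟨one_mem _, one_mem _⟩, fun a _ => by simp⟩
  mul_mem' := by
    rintro g h ⟨⟨h1, h2⟩, h3⟩ ⟨⟨h4, h5⟩, h6⟩
    refine ⟨⟨mul_mem h1 h4, mul_mem h2 h5⟩, fun a ha => ?_⟩
    have := mul_mem ((mem_normalizer_iff.1 h2 _).1 (h6 a ha)) (h3 a ha)
    convert this using 1
    group
  inv_mem' := by
    rintro g ⟨⟨h1, h2⟩, h3⟩
    refine ⟨⟨inv_mem h1, inv_mem h2⟩, fun a ha => ?_⟩
    have := (mem_normalizer_iff''.1 h2 _).1 (inv_mem (h3 a ha))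
    convert this using 1
    group

theorem mem_secCent {A B : Subgroup G} {g : G} : g ∈ secCent A B ↔
    (g ∈ normalizer (A : Set G) ∧ g ∈ normalizer (B : Set G)) ∧
      ∀ a ∈ A, g * a * g⁻¹ * a⁻¹ ∈ B := Iff.rfl

theorem secCent_bot (A : Subgroup G) : secCent A ⊥ = centralizer (A : Set G) := by
  ext g
  rw [mem_secCent, mem_centralizer_iff]
  have : ∀ a, g * a * g⁻¹ * a⁻¹ = 1 ↔ a * g = g * a := by
    intro a
    rw [mul_inv_eq_one, mul_inv_eq_iff_eq_mul, eq_comm]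
  simp only [mem_bot, this]
  refine ⟨fun h => h.2, fun h => ⟨⟨centralizer_le_normalizer _ ?_, ?_⟩, h⟩⟩
  · exact mem_centralizer_iff.2 h
  · rw [normalizer_eq_top]; trivial

/-- `A / B` is a nonabelian simple section. -/
structure IsNonabelianSimpleSection (A B : Subgroup G) : Prop where
  le : B ≤ A
  le_normalizer : A ≤ normalizer (B : Set G)
  ne : B ≠ A
  simple : ∀ X, B ≤ X → X ≤ A → A ≤ normalizer (X : Set G) → X = B ∨ X = A
  nonabelian : ∃ s ∈ A, ∃ t ∈ A, s * t * s⁻¹ * t⁻¹ ∉ B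

theorem IsNonabelianSimpleSection.comap {G' : Type*} [Group G'] {f : G →* G'}
    (hf : Function.Surjective f) {A B : Subgroup G'} (h : IsNonabelianSimpleSection A B) :
    IsNonabelianSimpleSection (A.comap f) (B.comap f) := by
  refine ⟨comap_mono h.le, (comap_mono h.le_normalizer).trans (le_normalizer_comap f),
    fun e => h.ne (comap_injective hf e), fun X hBX hXA hn => ?_, ?_⟩
  · have hX : (X.map f).comap f = X :=
      comap_map_eq_self ((MonoidHom.ker_le_comap f B).trans hBX)
    have := h.simple (X.map f) (by
      rw [← map_comap_eq_self_of_surjective hf B]; exact map_mono hBX)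
      (map_le_iff_le_comap.2 hXA) (by
        rw [← map_comap_eq_self_of_surjective hf A]
        exact (map_mono hn).trans (le_normalizer_map f))
    rw [← hX]
    exact this.imp (congrArg _) (congrArg _)
  · obtain ⟨s, hs, t, ht, hst⟩ := h.nonabelian
    obtain ⟨s, rfl⟩ := hf s
    obtain ⟨t, rfl⟩ := hf t
    exact ⟨s, hs, t, ht, by simpa [mem_comap] using hst⟩

theorem IsNonabelianSimpleSection.map {G' : Type*} [Group G'] {f : G →* G'}
    (hf : Function.Injective f) {A B : Subgroup G} (h : IsNonabelianSimpleSection A B) :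
    IsNonabelianSimpleSection (A.map f) (B.map f) := by
  refine ⟨map_mono h.le, (map_mono h.le_normalizer).trans (le_normalizer_map f),
    fun e => h.ne (map_injective hf e), fun X hBX hXA hn => ?_, ?_⟩
  · have hX : (X.comap f).map f = X := by
      rw [map_comap_eq, inf_eq_right]
      exact hXA.trans (map_le_range f A)
    have := h.simple (X.comap f) (map_le_iff_le_comap.1 hBX) (by
      rw [← comap_map_eq_self_of_injective hf A]; exact comap_mono hXA) (fun a ha => by
        rw [← mem_normalizer_map_iff hf, hX]
        exact hn (mem_map_of_mem f ha))
    rw [← hX]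
    exact this.imp (congrArg _) (congrArg _)
  · obtain ⟨s, hs, t, ht, hst⟩ := h.nonabelian
    refine ⟨f s, mem_map_of_mem f hs, f t, mem_map_of_mem f ht, fun hm => hst ?_⟩
    rwa [← map_inv, ← map_inv, ← map_mul, ← map_mul, ← map_mul, mem_map_iff_mem hf] at hm

theorem secCent_comap {G' : Type*} [Group G'] {f : G →* G'}
    (hf : Function.Surjective f) (A B : Subgroup G') :
    secCent (A.comap f) (B.comap f) = (secCent A B).comap f := by
  ext g
  rw [mem_comap, mem_secCent, mem_secCent, ← comap_normalizer_eq_of_surjective _ hf,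
    ← comap_normalizer_eq_of_surjective _ hf]
  refine and_congr Iff.rfl ⟨fun h a ha => ?_, fun h a ha => ?_⟩
  · obtain ⟨a, rfl⟩ := hf a
    simpa [mem_comap] using h a ha
  · simpa [mem_comap] using h (f a) ha

theorem secCent_map {G' : Type*} [Group G'] {f : G →* G'}
    (hf : Function.Injective f) (A B : Subgroup G) :
    (secCent (A.map f) (B.map f)).comap f = secCent A B := by
  ext g
  rw [mem_comap, mem_secCent, mem_secCent, mem_normalizer_map_iff hf, mem_normalizer_map_iff hf]
  have key : ∀ a, f g * f a * (f g)⁻¹ * (f a)⁻¹ ∈ B.map f ↔ g * a * g⁻¹ * a⁻¹ ∈ B := fun a => by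
    rw [← map_inv, ← map_inv, ← map_mul, ← map_mul, ← map_mul, mem_map_iff_mem hf]
  refine and_congr Iff.rfl ⟨fun h a ha => (key a).1 (h _ (mem_map_of_mem f ha)), ?_⟩
  rintro h _ ⟨a, ha, rfl⟩
  exact (key a).2 (h a ha)

/-- `A` is a normal subgroup of `B`. -/
def NormalStep (A B : Subgroup G) : Prop := A ≤ B ∧ B ≤ normalizer (A : Set G)

/-- `A` is a subnormal subgroup of `B`. -/
def SubnormalIn (A B : Subgroup G) : Prop := Relation.ReflTransGen NormalStep A B

theorem SubnormalIn.comap {G' : Type*} [Group G'] (f : G →* G') {A B : Subgroup G'}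
    (h : SubnormalIn A B) : SubnormalIn (A.comap f) (B.comap f) :=
  by
  refine Relation.ReflTransGen.lift (Subgroup.comap f) (fun _ _ h => ?_) _ _ h
  exact ⟨comap_mono h.1, (comap_mono h.2).trans (le_normalizer_comap f)⟩

theorem SubnormalIn.map {G' : Type*} [Group G'] (f : G →* G') {A B : Subgroup G}
    (h : SubnormalIn A B) : SubnormalIn (A.map f) (B.map f) :=
  by
  refine Relation.ReflTransGen.lift (Subgroup.map f) (fun _ _ h => ?_) _ _ h
  exact ⟨map_mono h.1, (map_mono h.2).trans (le_normalizer_map f)⟩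

/-- The relative form of `(*)`: only sections of `N` are taken into account, and
`⟨Aut_M(A/B), A/B⟩` is written as a section of `G`. -/
def StarRel (G : Type*) [Group G] (N : Subgroup G) : Prop :=
  ∀ A B : Subgroup G, IsNonabelianSimpleSection A B → SubnormalIn A N →
    ∀ M : Subgroup G, Group.IsNilpotent M → M ≤ normalizer (A : Set G) →
      M ≤ normalizer (B : Set G) → RelCarterConj (M ⊔ A) (secCent A B)

/-- The image of P is a Sylow subgroup of a nilpotent group, hence normal, so P ker f is normal in
G. The Frattini argument gives G = N(P) ker f. -/
theorem Sylow.map_normalizer_eq_top {G' : Type*} [Group G'] [Finite G] {f : G →* G'}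
    (hf : Function.Surjective f) (hG' : Group.IsNilpotent G') {p : ℕ} [Fact p.Prime]
    (P : Sylow p G) : (normalizer ((P : Subgroup G) : Set G)).map f = ⊤ := by
  have : Finite G' := Finite.of_surjective f hf
  have hn : ((P.mapSurjective hf : Sylow p G') : Subgroup G').Normal := inferInstance
  have hc := hn.comap f
  rw [Sylow.coe_mapSurjective, comap_map_eq] at hc
  have h1 : normalizer ((P : Subgroup G) : Set G) ⊔ ((P : Subgroup G) ⊔ f.ker) = ⊤ :=
    Sylow.normalizer_sup_eq_top' P le_sup_left
  rw [← sup_assoc, sup_eq_left.2 le_normalizer] at h1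
  have := congrArg (Subgroup.map f) h1
  rwa [Subgroup.map_sup, (Subgroup.map_eq_bot_iff f.ker).2 le_rfl, sup_bot_eq,
    map_top_of_surjective f hf] at this

/-- Nilpotent subgroups lift along surjections of finite groups. -/
theorem exists_isNilpotent_map_eq {G' : Type*} [Group G'] [Finite G] {f : G →* G'}
    (hf : Function.Surjective f) {M : Subgroup G'} (hM : Group.IsNilpotent M) :
    ∃ M' : Subgroup G, Group.IsNilpotent M' ∧ M'.map f = M := by
  -- Take M' minimal among the subgroups mapping onto M. The normalizer in M' of any Sylow subgroup
  -- of M' still maps onto M, so it is M' itself.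
  obtain ⟨M', -, hM'⟩ := exists_minimal_le_of_wellFoundedLT
    (fun X : Subgroup G => X.map f = M) (M.comap f) (map_comap_eq_self_of_surjective hf M)
  refine ⟨M', ?_, hM'.1⟩
  have hs : Group.IsNilpotent M' ↔
      ∀ (p : ℕ) (_ : Fact p.Prime) (P : Sylow p M'), (P : Subgroup M').Normal :=
    (Group.isNilpotent_of_finite_tfae (G := M')).out 0 3
  rw [hs]
  intro p hp P
  have h2 := Sylow.map_normalizer_eq_top (f.subgroupMap_surjective M')
    (by rw [hM'.1]; exact hM) P
  set R := normalizer ((P : Subgroup M') : Set M')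
  have h3 : (R.map M'.subtype).map f = M := by
    have := congrArg (Subgroup.map (M'.map f).subtype) h2
    rw [← MonoidHom.range_eq_map, range_subtype, map_map] at this
    rw [map_map]
    exact this.trans hM'.1
  have h4 := hM'.2 h3 (map_subtype_le R)
  rw [← normalizer_eq_top_iff, eq_top_iff]
  intro x _
  obtain ⟨y, hy, e⟩ := h4 x.2
  rwa [← Subtype.ext e]

/-- Sections pull back along f, and a nilpotent subgroup of G' is the image of a nilpotent subgroup
of G, to which the hypothesis applies. -/
theorem StarRel.map_of_surjective {G' : Type*} [Group G'] [Finite G] {f : G →* G'}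
    (hf : Function.Surjective f) {N : Subgroup G} (hN : f.ker ≤ N) (h : StarRel G N) :
    StarRel G' (N.map f) := by
  intro A B hAB hA M hM hMA hMB
  obtain ⟨M', hM', rfl⟩ := exists_isNilpotent_map_eq hf hM
  refine RelCarterConj.of_comap hf ?_
  have e : (M'.map f ⊔ A).comap f = M' ⊔ A.comap f := by
    rw [← map_comap_eq_self_of_surjective hf A, ← Subgroup.map_sup, comap_map_eq_self,
      map_comap_eq_self_of_surjective hf A]
    exact (MonoidHom.ker_le_comap f A).trans le_sup_right
  rw [e, ← secCent_comap hf]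
  have hA' := hA.comap f
  rw [comap_map_eq_self hN] at hA'
  refine h _ _ (hAB.comap hf) hA' M' hM' ?_ ?_
  · rw [← comap_normalizer_eq_of_surjective _ hf]
    exact map_le_iff_le_comap.1 hMA
  · rw [← comap_normalizer_eq_of_surjective _ hf]
    exact map_le_iff_le_comap.1 hMB

/-- W need not lie in N or be subnormal: only sections subnormal in V are tested, and these are
subnormal in N. This inheritance is the purpose of the relative form. -/
theorem StarRel.subgroupOf {N V W : Subgroup G} (hVN : SubnormalIn V N) (hVW : V ≤ W)
    (h : StarRel G N) : StarRel W (V.subgroupOf W) := by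
  intro A B hAB hA M hM hMA hMB
  have hinj := W.subtype_injective
  have hA' := hA.map W.subtype
  rw [subgroupOf_map_subtype, inf_eq_left.2 hVW] at hA'
  have := h _ _ (hAB.map hinj) (hA'.trans hVN) (M.map W.subtype) (isNilpotent_map _ hM)
    ((map_mono hMA).trans (le_normalizer_map _)) ((map_mono hMB).trans (le_normalizer_map _))
  rw [← Subgroup.map_sup] at this
  have := this.of_map hinj
  rwa [secCent_map hinj] at this

end Relative

/-! ### From composition factors to subnormal nonabelian simple sections. -/

section Sections

variable {G : Type*} [Group G]

theorem isSimpleGroup_quotient {A B : Subgroup G} [(B.subgroupOf A).Normal] (hBA : B ≤ A)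
    (hne : B ≠ A)
    (h : ∀ X, B ≤ X → X ≤ A → A ≤ normalizer (X : Set G) → X = B ∨ X = A) :
    IsSimpleGroup (A ⧸ B.subgroupOf A) := by
  have hs := QuotientGroup.mk'_surjective (B.subgroupOf A)
  have : Nontrivial (A ⧸ B.subgroupOf A) := by
    rw [QuotientGroup.nontrivial_iff]
    exact fun e => hne (le_antisymm hBA (subgroupOf_eq_top.1 e))
  refine ⟨fun H hH => ?_⟩
  have hc := hH.comap (QuotientGroup.mk' (B.subgroupOf A))
  set Y := H.comap (QuotientGroup.mk' (B.subgroupOf A))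
  have hBY : B.subgroupOf A ≤ Y := by
    have := MonoidHom.ker_le_comap (QuotientGroup.mk' (B.subgroupOf A)) H
    rwa [QuotientGroup.ker_mk'] at this
  have hYH : Y.map (QuotientGroup.mk' (B.subgroupOf A)) = H :=
    map_comap_eq_self_of_surjective hs H
  rw [← map_subtype_le_map_subtype, subgroupOf_map_subtype, inf_eq_left.2 hBA] at hBY
  have hYn : A ≤ normalizer (Y.map A.subtype : Set G) := by
    rw [le_normalizer_iff]
    rintro a ha _ ⟨y, hy, rfl⟩
    exact ⟨⟨a, ha⟩ * y * ⟨a, ha⟩⁻¹, hc.conj_mem y hy _, rfl⟩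
  rcases h (Y.map A.subtype) hBY (map_subtype_le Y) hYn with e | e
  · left
    rw [← hYH, Subgroup.map_eq_bot_iff, QuotientGroup.ker_mk', ← map_subtype_le_map_subtype, e,
      subgroupOf_map_subtype, inf_eq_left.2 hBA]
  · right
    have : Y = ⊤ := by
      rw [eq_top_iff, ← map_subtype_le_map_subtype, e]
      exact map_subtype_le _
    rw [← hYH, this, map_top_of_surjective _ hs]

/-- Normal inclusions of finite groups refine to composition series. -/
theorem NormalStep.reflTransGen_isCompositionStep [Finite G] {A B : Subgroup G}
    (h : NormalStep B A) : Relation.ReflTransGen IsCompositionStep B A := by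
  induction hn : Nat.card A using Nat.strong_induction_on generalizing A with
  | _ n ih =>
  subst hn
  -- If B ≠ A, a maximal proper normal subgroup C of A above B gives the top step; induction handles
  -- B in C.
  by_cases hBA : B = A
  · rw [hBA]
  obtain ⟨C, hBC, hC⟩ := exists_maximal_ge_of_wellFoundedGT
    (fun X : Subgroup G => X < A ∧ A ≤ normalizer (X : Set G)) B ⟨lt_of_le_of_ne h.1 hBA, h.2⟩
  have hn := normal_subgroupOf_of_le_normalizer hC.1.2
  refine (ih _ ?_ ⟨hBC, hC.1.1.le.trans h.2⟩ rfl).tail ⟨hC.1.1.le, hn, ?_⟩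
  · exact lt_of_not_ge fun hcard => hC.1.1.ne (eq_of_le_of_card_ge hC.1.1.le hcard)
  · refine isSimpleGroup_quotient hC.1.1.le hC.1.1.ne fun X hCX hXA hX => ?_
    by_cases hne : X = A
    · exact Or.inr hne
    · exact Or.inl (le_antisymm (hC.2 ⟨lt_of_le_of_ne hXA hne, hX⟩ hCX) hCX)

theorem SubnormalIn.reflTransGen_isCompositionStep [Finite G] {A B : Subgroup G}
    (h : SubnormalIn B A) : Relation.ReflTransGen IsCompositionStep B A := by
  induction h with
  | refl => exact Relation.ReflTransGen.refl
  | tail _ h ih => exact ih.trans h.reflTransGen_isCompositionStep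

theorem normalStep_bot (A : Subgroup G) : NormalStep ⊥ A :=
  ⟨bot_le, by rw [normalizer_eq_top]; exact le_top⟩

theorem IsNonabelianSimpleSection.isCompositionFactor [Finite G] {A B : Subgroup G}
    (h : IsNonabelianSimpleSection A B) (hA : SubnormalIn A ⊤) : IsCompositionFactor A B := by
  have hn := normal_subgroupOf_of_le_normalizer h.le_normalizer
  exact ⟨(normalStep_bot B).reflTransGen_isCompositionStep,
    ⟨h.le, hn, isSimpleGroup_quotient h.le h.ne h.simple⟩, hA.reflTransGen_isCompositionStep⟩

/-- The action on `A / B` of a subgroup normalizing `A` and `B`. -/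
def sectionAct (L A B : Subgroup G) [(B.subgroupOf A).Normal]
    (hL : L ≤ sectionNormalizer ⊤ A B) : L →* MulAut (A ⧸ B.subgroupOf A) :=
  (sectionHom ⊤ A B).comp (inclusion hL)

theorem ker_sectionAct (L A B : Subgroup G) [(B.subgroupOf A).Normal]
    (hL : L ≤ sectionNormalizer ⊤ A B) :
    (sectionAct L A B hL).ker = (secCent A B).subgroupOf L := by
  ext l
  rw [MonoidHom.mem_ker, mem_subgroupOf, mem_secCent, and_iff_right (mem_inf.1 (hL l.2).2)]
  have key : ∀ a : A, sectionAct L A B hL l (a : A ⧸ B.subgroupOf A) = a ↔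
      (l : G) * a * (l : G)⁻¹ * (a : G)⁻¹ ∈ B := by
    intro a
    change ((sectionConj ⊤ A B (inclusion hL l) a : A) : A ⧸ B.subgroupOf A) = a ↔ _
    rw [eq_comm, QuotientGroup.eq, Normal.mem_comm_iff inferInstance, mem_subgroupOf]
    rfl
  constructor
  · intro h a ha
    rw [← key ⟨a, ha⟩, h]
    rfl
  · intro h
    ext q
    induction q using QuotientGroup.induction_on with
    | H a => exact (key a).2 (h a a.2)

theorem range_sectionAct (M A B : Subgroup G) [(B.subgroupOf A).Normal]
    (hL : M ⊔ A ≤ sectionNormalizer ⊤ A B) :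
    (sectionAct (M ⊔ A) A B hL).range =
      inducedAut M A B ⊔ (MulAut.conj : (A ⧸ B.subgroupOf A) →* _).range := by
  have hM : ∀ m (hm : m ∈ M), sectionAct (M ⊔ A) A B hL ⟨m, le_sup_left (b := A) hm⟩ =
      sectionHom M A B ⟨m, hm, (hL (le_sup_left (b := A) hm)).2⟩ := fun m hm => rfl
  have hA : ∀ a (ha : a ∈ A), sectionAct (M ⊔ A) A B hL ⟨a, le_sup_right (a := M) ha⟩ =
      MulAut.conj ((⟨a, ha⟩ : A) : A ⧸ B.subgroupOf A) := by
    intro a ha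
    ext q
    induction q using QuotientGroup.induction_on with
    | H b => rfl
  apply le_antisymm
  · have : M ⊔ A ≤ ((inducedAut M A B ⊔ (MulAut.conj : (A ⧸ B.subgroupOf A) →* _).range).comap
        (sectionAct (M ⊔ A) A B hL)).map (M ⊔ A).subtype := by
      refine sup_le (fun m hm => ⟨⟨m, le_sup_left (b := A) hm⟩, ?_, rfl⟩)
        fun a ha => ⟨⟨a, le_sup_right (a := M) ha⟩, ?_, rfl⟩
      · refine mem_sup_left ?_
        rw [hM m hm]
        exact ⟨_, rfl⟩
      · refine mem_sup_right ?_
        rw [hA a ha]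
        exact ⟨_, rfl⟩
    rintro _ ⟨l, rfl⟩
    obtain ⟨l', hl', e⟩ := this l.2
    rw [← Subtype.ext e]
    exact hl'
  · refine sup_le ?_ ?_
    · rintro _ ⟨x, rfl⟩
      exact ⟨_, hM x x.2.1⟩
    · rintro _ ⟨q, rfl⟩
      induction q using QuotientGroup.induction_on with
      | H a => exact ⟨_, hA a a.2⟩

/-- A subnormal simple section is a composition factor. The action of MA on A/B has image
⟨Aut_M(A/B), A/B⟩ and kernel MA ∩ C(A/B), so the two forms of conjugacy match. -/
theorem SatisfiesStar.starRel [Finite G] (h : SatisfiesStar G) : StarRel G ⊤ := by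
  intro A B hAB hA M hM hMA hMB
  have hn := normal_subgroupOf_of_le_normalizer hAB.le_normalizer
  have hL : M ⊔ A ≤ sectionNormalizer ⊤ A B :=
    le_inf le_top (sup_le (le_inf hMA hMB) (le_inf le_normalizer hAB.le_normalizer))
  have := h A B (hAB.isCompositionFactor hA) (fun hc => by
    obtain ⟨s, hs, t, ht, hst⟩ := hAB.nonabelian
    have := hc ((⟨s, hs⟩ : A) : A ⧸ B.subgroupOf A) ((⟨t, ht⟩ : A) : A ⧸ B.subgroupOf A)
    rw [← QuotientGroup.mk_mul, ← QuotientGroup.mk_mul, eq_comm, QuotientGroup.eq,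
      Normal.mem_comm_iff inferInstance, mem_subgroupOf] at this
    refine hst ?_
    simpa [mul_assoc] using this) M hM
  rw [← range_sectionAct M A B hL] at this
  refine relCarterConj_of_surjective (sectionAct (M ⊔ A) A B hL).rangeRestrict
    (MonoidHom.rangeRestrict_surjective _) ?_ this
  rw [MonoidHom.ker_rangeRestrict, ker_sectionAct]

end Sections

/-! ### Factors of a nonabelian minimal normal subgroup. -/

section Factors

variable {G : Type*} [Group G]

/-- `U` is a minimal normal subgroup of `V`. -/
def IsFactor (V U : Subgroup G) : Prop := U ≤ V ∧ IsMinNormalizedBy V U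

theorem IsFactor.conjugate {V U : Subgroup G} [V.Normal] (h : IsFactor V U) (g : G) :
    IsFactor V (cj g U) := by
  have hV : ∀ a, cj a V = V := fun a => cj_of_normal a V
  refine ⟨hV g ▸ cj_mono h.1, fun e => h.2.1 ?_, ?_, fun W hW hn => ?_⟩
  · rw [← cj_inv_cj g U, e]; exact Subgroup.map_bot _
  · rw [← cj_normalizer, ← hV g]; exact cj_mono h.2.2.1
  · have h1 : cj g⁻¹ W ≤ U := by rw [← cj_le_cj (a := g)]; simpa using hW
    have h2 : V ≤ normalizer (cj g⁻¹ W : Set G) := by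
      rw [← cj_normalizer, ← hV g⁻¹]; exact cj_mono hn
    rcases h.2.2.2 _ h1 h2 with e | e
    · left; rw [← cj_cj_inv g W, e]; exact Subgroup.map_bot _
    · right; rw [← e]; simp

/-- By minimality U ∩ U' = 1, and commutators of U with U' lie in this intersection. -/
theorem IsFactor.le_centralizer {V U U' : Subgroup G} (h : IsFactor V U) (h' : IsFactor V U')
    (hne : U ≠ U') : U' ≤ centralizer (U : Set G) := by
  have hn : V ≤ normalizer ((U ⊓ U' : Subgroup G) : Set G) :=
    (le_inf h.2.2.1 h'.2.2.1).trans inf_normalizer_le_normalizer_inf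
  have hb : U ⊓ U' = ⊥ := by
    rcases h.2.2.2 _ inf_le_left hn with e | e
    · exact e
    · rcases h'.2.2.2 _ inf_le_right hn with e' | e'
      · exact e'
      · exact absurd (e.symm.trans e') hne
  intro a ha
  rw [mem_centralizer_iff_commutator_eq_one]
  intro b hb'
  have hb' : b ∈ U := hb'
  have : b * a * b⁻¹ * a⁻¹ ∈ U ⊓ U' := by
    refine ⟨?_, U'.mul_mem ((mem_normalizer_iff.1 (h'.2.2.1 (h.1 hb')) a).1 ha) (U'.inv_mem ha)⟩
    rw [mul_assoc, mul_assoc, ← mul_assoc a]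
    exact U.mul_mem hb' ((mem_normalizer_iff.1 (h.2.2.1 (h'.1 ha)) _).1 (U.inv_mem hb'))
  rw [hb, mem_bot] at this
  rw [commutatorElement_def]
  exact this

theorem le_normalizer_centralizer (U : Subgroup G) :
    normalizer (U : Set G) ≤ normalizer (centralizer (U : Set G) : Set G) := fun g hg => by
  rw [← cj_eq_self_iff] at hg ⊢
  rw [cj_centralizer, hg]

theorem IsMinNormalizedBy.inf_centralizer {V : Subgroup G} (hV : IsMinNormalizedBy ⊤ V)
    (hc : ¬ ∀ a ∈ V, ∀ b ∈ V, a * b = b * a) : V ⊓ centralizer (V : Set G) = ⊥ := by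
  have := hV.normal
  have hn : (V ⊓ centralizer (V : Set G)).Normal := normal_of_cj_eq fun g => by
    rw [cj_inf, cj_centralizer, cj_of_normal]
  refine (hV.eq_bot_or_eq hn inf_le_left).resolve_right fun e => hc fun a ha b hb => ?_
  rw [← e] at hb
  exact mem_centralizer_iff.1 hb.2 a ha

variable [Finite G] {V : Subgroup G}

theorem exists_isFactor (hV : V ≠ ⊥) : ∃ U, IsFactor V U := by
  obtain ⟨U, hU, h⟩ := exists_isMinNormalizedBy_le (L := V) hV le_normalizer
  exact ⟨U, hU, h⟩

/-- A minimal normal subgroup is generated by its own minimal normal subgroups. -/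
theorem IsMinNormalizedBy.le_of_factors_le (hV : IsMinNormalizedBy ⊤ V) {L : Subgroup G}
    (hL : ∀ U, IsFactor V U → U ≤ L) : V ≤ L := by
  have := hV.normal
  set W := sSup {U | IsFactor V U}
  have h1 : ∀ g, cj g W ≤ W := by
    intro g
    rw [← cj_le_cj (a := g⁻¹), cj_inv_cj]
    refine sSup_le fun U hU => ?_
    rw [← cj_le_cj (a := g), cj_cj_inv]
    exact le_sSup (IsFactor.conjugate hU g)
  have hW : W.Normal := normal_of_cj_eq fun g => cj_eq_of_le (h1 g)
  have hWV : W ≤ V := sSup_le fun U hU => hU.1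
  rcases hV.eq_bot_or_eq hW hWV with e | e
  · obtain ⟨U, hU⟩ := exists_isFactor hV.1
    exact absurd (le_bot_iff.1 (e ▸ le_sSup hU : U ≤ ⊥)) hU.2.1
  · rw [← e]
    exact sSup_le hL

/-- The factors generate V, so x lies in Z(V), which is trivial. Hence an element of V is determined
by its actions on the factors. -/
theorem eq_one_of_forall_mem_centralizer (hV : IsMinNormalizedBy ⊤ V)
    (hc : ¬ ∀ a ∈ V, ∀ b ∈ V, a * b = b * a) {x : G} (hx : x ∈ V)
    (h : ∀ U, IsFactor V U → x ∈ centralizer (U : Set G)) : x = 1 := by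
  have h1 : V ≤ centralizer {x} := hV.le_of_factors_le fun U hU u hu => by
    rw [mem_centralizer_singleton_iff]
    exact mem_centralizer_iff.1 (h U hU) u hu
  have h2 : x ∈ V ⊓ centralizer (V : Set G) := ⟨hx, mem_centralizer_iff.2 fun v hv =>
    mem_centralizer_singleton_iff.1 (h1 hv)⟩
  rwa [hV.inf_centralizer hc] at h2

/-- The other factors centralize U, so a normal subgroup of U is normal in V, and minimality of U
applies. An abelian U would be central in V. -/
theorem IsFactor.isNonabelianSimpleSection (hV : IsMinNormalizedBy ⊤ V)
    (hc : ¬ ∀ a ∈ V, ∀ b ∈ V, a * b = b * a) {U : Subgroup G} (hU : IsFactor V U) :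
    IsNonabelianSimpleSection U ⊥ := by
  refine ⟨bot_le, (normalStep_bot U).2, hU.2.1.symm, fun X _ hXU hn => ?_, ?_⟩
  · refine hU.2.2.2 X hXU (hV.le_of_factors_le fun U' hU' => ?_)
    by_cases e : U = U'
    · rwa [← e]
    · exact (hU.le_centralizer hU' e).trans
        ((centralizer_le hXU).trans (centralizer_le_normalizer _))
  · by_contra hcon
    push Not at hcon
    refine hU.2.1 (eq_bot_iff.2 fun x hx => ?_)
    refine eq_one_of_forall_mem_centralizer hV hc (hU.1 hx) fun U' hU' => ?_
    by_cases e : U' = U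
    · subst e
      rw [mem_centralizer_iff_commutator_eq_one]
      exact fun s hs => mem_bot.1 (hcon s hs x hx)
    · exact hU'.le_centralizer hU e hx

theorem exists_mul_centralizer_of_mem (hV : IsMinNormalizedBy ⊤ V) {U : Subgroup G}
    (hU : IsFactor V U) {v : G} (hv : v ∈ V) :
    ∃ t ∈ U, ∃ c ∈ centralizer (U : Set G), t * c = v := by
  rw [← mem_sup_of_le_normalizer (le_normalizer.trans (le_normalizer_centralizer U))]
  refine hV.le_of_factors_le (fun U' hU' => ?_) hv
  by_cases e : U = U'
  · rw [← e]; exact le_sup_left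
  · exact (hU.le_centralizer hU' e).trans le_sup_right

/-- Components in the factors can be prescribed independently. -/
theorem exists_mem_of_components (x : Subgroup G → G)
    (hx : ∀ U, IsFactor V U → x U ∈ U) :
    ∃ y ∈ V, ∀ U, IsFactor V U → (x U)⁻¹ * y ∈ centralizer (U : Set G) := by
  classical
  have key : ∀ s : Set (Subgroup G), s.Finite → ∃ y ∈ V,
      (∀ U ∈ s, IsFactor V U → (x U)⁻¹ * y ∈ centralizer (U : Set G)) ∧
      ∀ U ∉ s, IsFactor V U → y ∈ centralizer (U : Set G) := by
    intro s hs
    induction s, hs using Set.Finite.induction_on with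
    | empty => exact ⟨1, one_mem _, fun U hU => absurd hU (Set.notMem_empty U),
        fun U _ _ => one_mem _⟩
    | @insert T s hT _ ih =>
      obtain ⟨y, hy, h1, h2⟩ := ih
      by_cases hTF : IsFactor V T
      -- Multiplying by an element of T changes only the component at T, since T centralizes the
      -- other factors.
      · refine ⟨x T * y, mul_mem (hTF.1 (hx T hTF)) hy, fun U hU hUF => ?_, fun U hU hUF => ?_⟩
        · rcases hU with rfl | hU
          · rw [inv_mul_cancel_left]
            exact h2 _ hT hUF
          · have hne : U ≠ T := fun e => hT (e ▸ hU)
            have hxT := hUF.le_centralizer hTF hne (hx T hTF)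
            have := mem_centralizer_iff.1 hxT _ (inv_mem (hx U hUF))
            rw [← mul_assoc, this, mul_assoc]
            exact mul_mem hxT (h1 U hU hUF)
        · have hne : U ≠ T := fun e => hU (e ▸ Set.mem_insert _ _)
          exact mul_mem (hUF.le_centralizer hTF hne (hx T hTF))
            (h2 U (fun h => hU (Set.mem_insert_of_mem _ h)) hUF)
      · refine ⟨y, hy, fun U hU hUF => ?_, fun U hU hUF => ?_⟩
        · rcases hU with rfl | hU
          · exact absurd hUF hTF
          · exact h1 U hU hUF
        · exact h2 U (fun h => hU (Set.mem_insert_of_mem _ h)) hUF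
  obtain ⟨y, hy, h, -⟩ := key Set.univ Set.finite_univ
  exact ⟨y, hy, fun U => h U trivial⟩

end Factors

/-! ### Automorphisms induced on the factors. -/

section AutPreimage

variable {G : Type*} [Group G]

/-- The preimage in `N(U)` of the group of automorphisms of `U` induced by `H`. -/
def autPreimage (H U : Subgroup G) : Subgroup G :=
  (H ⊓ normalizer (U : Set G)) ⊔ centralizer (U : Set G)

theorem centralizer_le_autPreimage (H U : Subgroup G) :
    centralizer (U : Set G) ≤ autPreimage H U := le_sup_right

theorem autPreimage_le_normalizer (H U : Subgroup G) :
    autPreimage H U ≤ normalizer (U : Set G) :=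
  sup_le inf_le_right (centralizer_le_normalizer _)

theorem cj_autPreimage (g : G) (H U : Subgroup G) :
    cj g (autPreimage H U) = autPreimage (cj g H) (cj g U) := by
  unfold autPreimage
  rw [cj_sup, cj_inf, cj_normalizer, cj_centralizer]

theorem cj_autPreimage_of_mem {H : Subgroup G} {h : G} (hh : h ∈ H) (U : Subgroup G) :
    cj h (autPreimage H U) = autPreimage H (cj h U) := by
  rw [cj_autPreimage, cj_eq_of_mem hh]

/-- Modulo C(U), the subgroup is an image of H ∩ N(U), so it is nilpotent with the same n for every
U. -/
theorem lowerCentralSeries_autPreimage_le {H : Subgroup G} {n : ℕ}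
    (hn : H.lowerCentralSeries n = ⊥) (U : Subgroup G) :
    (autPreimage H U).lowerCentralSeries n ≤ centralizer (U : Set G) := by
  set N := normalizer (U : Set G)
  have hk : U.normalizerMonoidHom.ker = (centralizer (U : Set G)).subgroupOf N :=
    U.normalizerMonoidHom_ker
  set f := U.normalizerMonoidHom
  set M := (H ⊓ N).subgroupOf N
  have hA : (M ⊔ f.ker).map N.subtype = autPreimage H U := by
    rw [Subgroup.map_sup, hk, subgroupOf_map_subtype, subgroupOf_map_subtype,
      inf_eq_left.2 (inf_le_right : H ⊓ N ≤ N), inf_eq_left.2 (centralizer_le_normalizer _)]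
    rfl
  have hM : M.lowerCentralSeries n = ⊥ := by
    rw [← map_eq_bot_iff_of_injective _ N.subtype_injective, map_lowerCentralSeries,
      subgroupOf_map_subtype, eq_bot_iff, ← hn]
    exact lowerCentralSeries_mono n (inf_le_left.trans inf_le_left)
  rw [← hA, ← map_lowerCentralSeries]
  have : (M ⊔ f.ker).lowerCentralSeries n ≤ f.ker := by
    rw [← Subgroup.map_eq_bot_iff, map_lowerCentralSeries, Subgroup.map_sup,
      (Subgroup.map_eq_bot_iff f.ker).2 le_rfl, sup_bot_eq, ← map_lowerCentralSeries, hM,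
      Subgroup.map_bot]
  refine (map_mono this).trans ?_
  rw [hk]
  exact (subgroupOf_map_subtype _ _).le.trans inf_le_left

/-- The elements of `V` inducing on every factor of `V` an automorphism induced by `H`. -/
def autCore (V H : Subgroup G) : Subgroup G :=
  V ⊓ sInf (autPreimage H '' {U | IsFactor V U})

theorem mem_autCore {V H : Subgroup G} {x : G} :
    x ∈ autCore V H ↔ x ∈ V ∧ ∀ U, IsFactor V U → x ∈ autPreimage H U := by
  rw [autCore, mem_inf, mem_sInf]
  simp

theorem isSolvable_sup {H D : Subgroup G} (hn : H ≤ normalizer (D : Set G))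
    (hH : Group.IsSolvable H) (hD : Group.IsSolvable D) : Group.IsSolvable ↥(H ⊔ D) := by
  have hDn : (D.subgroupOf (H ⊔ D)).Normal := normal_subgroupOf_sup_of_le_normalizer hn
  let e := subgroupOfEquivOfLe (le_sup_right : D ≤ H ⊔ D)
  have h1 : Group.IsSolvable (D.subgroupOf (H ⊔ D)) :=
    Group.isSolvable_of_isSolvable_injective (f := e.toMonoidHom) e.injective
  have h2 : Group.IsSolvable (↥(H ⊔ D) ⧸ D.subgroupOf (H ⊔ D)) := by
    refine Group.isSolvable_of_surjective
      (f := (QuotientGroup.mk' (D.subgroupOf (H ⊔ D))).comp (inclusion (le_sup_left (b := D)))) ?_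
    intro q
    obtain ⟨⟨x, hx⟩, rfl⟩ := QuotientGroup.mk'_surjective _ q
    obtain ⟨a, ha, b, hb, rfl⟩ := (mem_sup_of_le_normalizer hn).1 hx
    refine ⟨⟨a, ha⟩, ?_⟩
    simpa [QuotientGroup.eq, mem_subgroupOf] using hb
  exact (Group.isSolvable_iff_subgroup_quotient (D.subgroupOf (H ⊔ D))).2 ⟨h1, h2⟩

variable [Finite G] {V : Subgroup G}

/-- With n such that the n-th lower central term of H vanishes, that of the core centralizes every
factor, hence is trivial. -/
theorem isNilpotent_autCore (hV : IsMinNormalizedBy ⊤ V)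
    (hc : ¬ ∀ a ∈ V, ∀ b ∈ V, a * b = b * a) {H : Subgroup G} (hH : Group.IsNilpotent H) :
    Group.IsNilpotent (autCore V H) := by
  obtain ⟨n, hn⟩ := (isNilpotent_iff_lowerCentralSeries H).1 hH
  refine isNilpotent_of_lowerCentralSeries_eq_bot (n := n) (eq_bot_iff.2 fun x hx => ?_)
  refine eq_one_of_forall_mem_centralizer hV hc ?_ fun U hU => ?_
  · exact inf_le_left (a := V) (lowerCentralSeries_le_self _ n hx)
  · refine lowerCentralSeries_autPreimage_le hn U (lowerCentralSeries_mono n ?_ hx)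
    exact fun y hy => (mem_autCore.1 hy).2 U hU

theorem le_normalizer_autCore [hV : V.Normal] (H : Subgroup G) :
    H ≤ normalizer (autCore V H : Set G) := by
  refine fun h hh => mem_normalizer_of_conj_mem fun x hx => ?_
  rw [mem_autCore] at hx ⊢
  refine ⟨hV.conj_mem x hx.1 h, fun U hU => ?_⟩
  have := hx.2 _ (hU.conjugate h⁻¹)
  rw [← conj_mem_cj (g := h), cj_autPreimage_of_mem hh] at this
  simpa using this

theorem carterSubgroupsConj_sup_autCore (hV : IsMinNormalizedBy ⊤ V)
    (hc : ¬ ∀ a ∈ V, ∀ b ∈ V, a * b = b * a) {H : Subgroup G} (hH : Group.IsNilpotent H) :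
    CarterSubgroupsConj ↥(H ⊔ autCore V H) := by
  have := hV.normal
  have h1 := isNilpotent_autCore hV hc hH
  have := isSolvable_sup (le_normalizer_autCore (V := V) H) inferInstance inferInstance
  exact carterSubgroupsConj_of_isSolvable _

end AutPreimage

/-! ### The nonabelian case, and conjugacy of Carter subgroups under (*). -/

section Main

variable {G : Type*} [Group G]

theorem IsFactor.cj_of_mem {V U : Subgroup G} (hU : IsFactor V U) {v : G} (hv : v ∈ V) :
    cj v U = U :=
  cj_eq_self_iff.2 (hU.2.2.1 hv)

theorem mem_autPreimage {H U : Subgroup G} {h : G} (hh : h ∈ H) (hn : h ∈ normalizer (U : Set G)) :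
    h ∈ autPreimage H U :=
  le_sup_left (a := H ⊓ normalizer (U : Set G)) ⟨hh, hn⟩

theorem mem_centerIn {K : Subgroup G} {z : G} :
    z ∈ centerIn K ↔ z ∈ K ∧ ∀ k ∈ K, k * z = z * k := by
  constructor
  · rintro ⟨z, hz, rfl⟩
    exact ⟨z.2, fun k hk => congrArg Subtype.val (mem_center_iff.1 hz ⟨k, hk⟩)⟩
  · rintro ⟨h1, h2⟩
    exact ⟨⟨z, h1⟩, mem_center_iff.2 fun k => Subtype.ext (h2 k k.2), rfl⟩

theorem le_centralizer_of_mem_centerIn {K : Subgroup G} {z : G} (hz : z ∈ centerIn K) :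
    K ≤ centralizer ({z} : Set G) := fun k hk =>
  mem_centralizer_singleton_iff.2 ((mem_centerIn.1 hz).2 k hk)

/-- If `z` is central in `K` and conjugate by `g` to a central element of `H`, then `g⁻¹ H g` and
`K` are conjugate in the centralizer of `z`. -/
theorem exists_cj_eq_of_mem_centerIn {K H : Subgroup G} (hK : IsCarter K) (hH : IsCarter H) {z : G}
    (hz : z ∈ centerIn K) (hC : CarterSubgroupsConj (centralizer ({z} : Set G))) {g : G}
    (hg : g * z * g⁻¹ ∈ centerIn H) :
    ∃ c ∈ centralizer ({z} : Set G), cj g⁻¹ H = cj c K := by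
  refine hC.exists_mem hK (hH.conjugate g⁻¹) (le_centralizer_of_mem_centerIn hz) fun x hx => ?_
  rw [mem_cj, inv_inv] at hx
  have := (mem_centerIn.1 hg).2 _ hx
  rw [mem_centralizer_singleton_iff]
  have := congrArg (fun t => g⁻¹ * t * g) this
  simpa [mul_assoc] using this

variable [Finite G] {V : Subgroup G}

/-- A Carter subgroup induces on each factor `T` of a minimal normal subgroup a group of
automorphisms that is self-normalizing in `T`. -/
theorem IsCarter.mem_autPreimage_of_mem_normalizer (hV : IsMinNormalizedBy ⊤ V)
    (hc : ¬ ∀ a ∈ V, ∀ b ∈ V, a * b = b * a) {H : Subgroup G} (hH : IsCarter H)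
    {T : Subgroup G} (hT : IsFactor V T) {x : G} (hx : x ∈ T)
    (hn : x ∈ normalizer (autPreimage H T : Set G)) : x ∈ autPreimage H T := by
  classical
  have hVn := hV.normal
  -- Spread x over the H-orbit of T by conjugation, with 1 off the orbit. The choice of conjugating
  -- element matters only modulo `autPreimage H U`, because x normalizes `autPreimage H T`.
  let X : Subgroup G → G := fun U =>
    if h : ∃ g ∈ H, cj g T = U then h.choose * x * h.choose⁻¹ else 1
  have hX1 : ∀ U, (∃ g ∈ H, cj g T = U) → ∃ g ∈ H, cj g T = U ∧ X U = g * x * g⁻¹ := by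
    intro U h
    exact ⟨h.choose, h.choose_spec.1, h.choose_spec.2, dif_pos h⟩
  have hX2 : ∀ U, (¬ ∃ g ∈ H, cj g T = U) → X U = 1 := fun U h => dif_neg h
  have hXU : ∀ U, IsFactor V U → X U ∈ U := by
    intro U _
    by_cases h : ∃ g ∈ H, cj g T = U
    · obtain ⟨g, -, h2, h3⟩ := hX1 U h
      rw [h3, ← h2, conj_mem_cj]
      exact hx
    · rw [hX2 U h]; exact one_mem _
  have hequiv : ∀ k ∈ H, ∀ U,
      (X (cj k U))⁻¹ * (k * X U * k⁻¹) ∈ autPreimage H (cj k U) := by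
    intro k hk U
    by_cases h : ∃ g ∈ H, cj g T = U
    · have h' : ∃ g ∈ H, cj g T = cj k U := by
        obtain ⟨g, hg, e⟩ := h
        exact ⟨k * g, mul_mem hk hg, by rw [cj_mul, e]⟩
      obtain ⟨g, hg, e, hXg⟩ := hX1 U h
      obtain ⟨g', hg', e', hXg'⟩ := hX1 _ h'
      set t := g'⁻¹ * k * g
      have ht : t ∈ autPreimage H T := by
        refine mem_autPreimage (mul_mem (mul_mem (inv_mem hg') hk) hg) ?_
        rw [← cj_eq_self_iff, cj_mul, cj_mul, e, ← e', cj_inv_cj]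
      have h1 : x⁻¹ * t * x * t⁻¹ ∈ autPreimage H T :=
        mul_mem ((mem_normalizer_iff''.1 hn t).1 ht) (inv_mem ht)
      rw [← e', ← cj_autPreimage_of_mem hg', e', hXg, hXg', mem_cj]
      convert h1 using 1
      simp only [t]
      group
    · have h' : ¬ ∃ g ∈ H, cj g T = cj k U := by
        rintro ⟨g, hg, e⟩
        exact h ⟨k⁻¹ * g, mul_mem (inv_mem hk) hg, by rw [cj_mul, e, cj_inv_cj]⟩
      rw [hX2 U h, hX2 _ h']
      simp
  obtain ⟨y, hyV, hy⟩ := exists_mem_of_components X hXU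
  -- By equivariance y commutes with H modulo the core, so y⁻¹Hy lies in the solvable group H ·
  -- `autCore V H`, and Frattini there forces y into it.
  have hcomm : ∀ k ∈ H, y⁻¹ * k * y * k⁻¹ ∈ autCore V H := by
    intro k hk
    rw [mem_autCore]
    refine ⟨?_, fun U hU => ?_⟩
    · have := mul_mem (inv_mem hyV) (hVn.conj_mem y hyV k)
      convert this using 1
      group
    · obtain ⟨U, rfl⟩ : ∃ U', U = cj k U' := ⟨cj k⁻¹ U, by simp⟩
      have hU' : IsFactor V U := by simpa using hU.conjugate k⁻¹
      have h1 := centralizer_le_autPreimage H _ (hy _ hU)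
      have h2 : k * ((X U)⁻¹ * y) * k⁻¹ ∈ autPreimage H (cj k U) := by
        rw [← cj_autPreimage_of_mem hk, conj_mem_cj]
        exact centralizer_le_autPreimage H _ (hy _ hU')
      have := mul_mem (mul_mem (inv_mem h1) (hequiv k hk U)) h2
      convert this using 1
      group
  have hle : cj y⁻¹ H ≤ H ⊔ autCore V H := by
    intro z hz
    rw [mem_cj, inv_inv] at hz
    have := mul_mem (mem_sup_right (S := H) (hcomm _ hz)) (mem_sup_left (T := autCore V H) hz)
    convert this using 1
    group
  have hyW : y ∈ H ⊔ autCore V H := by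
    rw [← inv_mem_iff]
    exact hH.mem_of_cj_le (carterSubgroupsConj_sup_autCore hV hc hH.1) le_sup_left hle
  obtain ⟨h, hh, d, hd, e⟩ := (mem_sup_of_le_normalizer (le_normalizer_autCore H)).1 hyW
  rw [mem_autCore] at hd
  -- Since y and d lie in V, so does h; hence h normalizes T and induces on it an automorphism from
  -- H.
  have hhV : h ∈ V := by
    rw [eq_mul_inv_of_mul_eq e]; exact mul_mem hyV (inv_mem hd.1)
  have hyA : y ∈ autPreimage H T := by
    rw [← e]
    exact mul_mem (mem_autPreimage hh (hT.2.2.1 hhV)) (hd.2 T hT)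
  have hXA : X T ∈ autPreimage H T := by
    have := mul_mem hyA (inv_mem (centralizer_le_autPreimage H _ (hy T hT)))
    simpa using this
  obtain ⟨g, hg, e', hXg⟩ := hX1 T ⟨1, one_mem _, by simp⟩
  have := cj_autPreimage_of_mem hg T
  rwa [hXg, ← e', ← this, conj_mem_cj] at hXA

theorem exists_mul_mul_of_mem_normalizer (hV : IsMinNormalizedBy ⊤ V) {H : Subgroup G}
    (hHV : H ⊔ V = ⊤) {T : Subgroup G} (hT : IsFactor V T) {g : G}
    (hg : g ∈ normalizer (T : Set G)) :
    ∃ h ∈ H, h ∈ normalizer (T : Set G) ∧ ∃ t ∈ T, ∃ c ∈ centralizer (T : Set G),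
      h * t * c = g := by
  have := hV.normal
  obtain ⟨h, hh, v, hv, rfl⟩ := mem_sup_of_normal.1 (hHV ▸ mem_top g : g ∈ H ⊔ V)
  obtain ⟨t, ht, c, hcc, rfl⟩ := exists_mul_centralizer_of_mem hV hT hv
  refine ⟨h, hh, ?_, t, ht, c, hcc, mul_assoc _ _ _⟩
  have := mul_mem hg (inv_mem (hT.2.2.1 hv))
  rwa [mul_inv_cancel_right] at this

/-- As HV = G, an element of N(T) is a product htc with h ∈ H ∩ N(T), t ∈ T, c ∈ C(T).
Self-normalization thus reduces to t, the case already settled. -/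
theorem IsCarter.relCarter_autPreimage (hV : IsMinNormalizedBy ⊤ V)
    (hc : ¬ ∀ a ∈ V, ∀ b ∈ V, a * b = b * a) {H : Subgroup G} (hH : IsCarter H)
    (hHV : H ⊔ V = ⊤) {T : Subgroup G} (hT : IsFactor V T) :
    RelCarter (normalizer (T : Set G)) (centralizer (T : Set G)) (autPreimage H T) := by
  refine ⟨inf_le_left.trans (centralizer_le_autPreimage H T), autPreimage_le_normalizer H T, ?_, ?_⟩
  · obtain ⟨n, hn⟩ := (isNilpotent_iff_lowerCentralSeries H).1 hH.1
    exact ⟨n, lowerCentralSeries_autPreimage_le hn T⟩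
  · intro g hg hgn
    obtain ⟨h, hh, hhT, t, ht, c, hcc, rfl⟩ := exists_mul_mul_of_mem_normalizer hV hHV hT hg
    have hhA := mem_autPreimage hh hhT
    have hcA := centralizer_le_autPreimage H T hcc
    have htn : t ∈ normalizer (autPreimage H T : Set G) := by
      have := mul_mem (inv_mem (le_normalizer hhA)) (mul_mem hgn (inv_mem (le_normalizer hcA)))
      simpa [mul_assoc] using this
    exact mul_mem (mul_mem hhA (hH.mem_autPreimage_of_mem_normalizer hV hc hT ht htn)) hcA

theorem exists_cj_autPreimage_eq (hV : IsMinNormalizedBy ⊤ V)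
    (hc : ¬ ∀ a ∈ V, ∀ b ∈ V, a * b = b * a) {N : Subgroup G} (hN : StarRel G N) (hVN : V ≤ N)
    {H K : Subgroup G} (hH : IsCarter H) (hK : IsCarter K) (hHV : H ⊔ V = ⊤) (hKV : K ⊔ V = ⊤)
    {T : Subgroup G} (hT : IsFactor V T) :
    ∃ t ∈ T, autPreimage K T = cj t (autPreimage H T) := by
  have hVn := hV.normal
  set M := H ⊓ normalizer (T : Set G)
  have hM : Group.IsNilpotent M := by
    have := hH.1
    exact Group.nilpotent_of_mulEquiv (subgroupOfEquivOfLe (inf_le_left : M ≤ H))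
  have hTN : SubnormalIn T N :=
    (Relation.ReflTransGen.single ⟨hT.1, hT.2.2.1⟩).tail ⟨hVN, le_normalizer_of_normal⟩
  have h1 := hN T ⊥ (hT.isNonabelianSimpleSection hV hc) hTN M hM inf_le_right
    (normalizer_eq_top (H := (⊥ : Subgroup G)) ▸ le_top)
  have hMT : M ⊔ T ≤ normalizer (T : Set G) := sup_le inf_le_right le_normalizer
  rw [secCent_bot] at h1
  have h2 := h1.sup (hMT.trans (le_normalizer_centralizer T))
  have e : M ⊔ T ⊔ centralizer (T : Set G) = normalizer (T : Set G) := by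
    refine le_antisymm (sup_le hMT (centralizer_le_normalizer _)) fun g hg => ?_
    obtain ⟨h, hh, hhT, t, ht, c, hcc, rfl⟩ := exists_mul_mul_of_mem_normalizer hV hHV hT hg
    exact mul_mem_sup (mul_mem_sup ⟨hh, hhT⟩ ht) hcc
  rw [e] at h2
  obtain ⟨g, hg, e⟩ := h2 _ _ (hH.relCarter_autPreimage hV hc hHV hT)
    (hK.relCarter_autPreimage hV hc hKV hT)
  obtain ⟨h, hh, hhT, t, ht, c, hcc, rfl⟩ := exists_mul_mul_of_mem_normalizer hV hHV hT hg
  refine ⟨h * t * h⁻¹, (mem_normalizer_iff.1 hhT t).1 ht, ?_⟩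
  rw [e]
  -- The factor hc lies in `autPreimage H T`, so the conjugating element may be taken in T.
  have h3 : h * t * c = h * t * h⁻¹ * (h * c) := by group
  rw [h3, cj_mul _ (h * c), cj_eq_of_mem
    (mul_mem (mem_autPreimage hh hhT) (centralizer_le_autPreimage H T hcc))]

/-- Write k ∈ K as hn with h ∈ H, n ∈ V. Both k and h carry the common preimage at U to the one at
hU, so n normalizes it and hence lies in it. Thus K ≤ H · `autCore V H`, which is solvable. -/
theorem carter_conj_of_autPreimage_eq (hV : IsMinNormalizedBy ⊤ V)
    (hc : ¬ ∀ a ∈ V, ∀ b ∈ V, a * b = b * a) {H K : Subgroup G} (hH : IsCarter H)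
    (hK : IsCarter K) (hHV : H ⊔ V = ⊤)
    (hA : ∀ U, IsFactor V U → autPreimage H U = autPreimage K U) : SubgroupsConj H K := by
  have hVn := hV.normal
  have hle : K ≤ H ⊔ autCore V H := by
    intro k hk
    obtain ⟨h, hh, n, hn, rfl⟩ := mem_sup_of_normal.1 (hHV ▸ mem_top k : k ∈ H ⊔ V)
    refine mul_mem_sup hh (mem_autCore.2 ⟨hn, fun U hU => ?_⟩)
    have hnn : n ∈ normalizer (autPreimage H U : Set G) := by
      rw [← cj_eq_self_iff]
      have h1 : cj (h * n) (autPreimage H U) = cj h (autPreimage H U) := by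
        rw [hA U hU, cj_autPreimage_of_mem hk, ← hA _ (hU.conjugate _), cj_mul, hU.cj_of_mem hn,
          ← cj_autPreimage_of_mem hh, hA U hU]
      rw [cj_mul] at h1
      exact le_antisymm (cj_le_cj.1 h1.le) (cj_le_cj.1 h1.ge)
    obtain ⟨t, ht, c, hcc, rfl⟩ := exists_mul_centralizer_of_mem hV hU hn
    have hcA := centralizer_le_autPreimage H U hcc
    have htn : t ∈ normalizer (autPreimage H U : Set G) := by
      simpa using mul_mem hnn (inv_mem (le_normalizer hcA))
    exact mul_mem (hH.mem_autPreimage_of_mem_normalizer hV hc hU ht htn) hcA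
  obtain ⟨w, -, hw⟩ :=
    (carterSubgroupsConj_sup_autCore hV hc hH.1).exists_mem hH hK le_sup_left hle
  exact subgroupsConj_iff.2 ⟨w, hw⟩

theorem carter_conj_of_sup_eq_top (hV : IsMinNormalizedBy ⊤ V)
    (hc : ¬ ∀ a ∈ V, ∀ b ∈ V, a * b = b * a) {N : Subgroup G} (hN : StarRel G N) (hVN : V ≤ N)
    {H K : Subgroup G} (hH : IsCarter H) (hK : IsCarter K) (hHV : H ⊔ V = ⊤) (hKV : K ⊔ V = ⊤) :
    SubgroupsConj H K := by
  classical
  have hVn := hV.normal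
  have h1 : ∀ U, ∃ t, IsFactor V U → t ∈ U ∧ autPreimage K U = cj t (autPreimage H U) := by
    intro U
    by_cases hU : IsFactor V U
    · obtain ⟨t, ht, e⟩ := exists_cj_autPreimage_eq hV hc hN hVN hH hK hHV hKV hU
      exact ⟨t, fun _ => ⟨ht, e⟩⟩
    · exact ⟨1, fun h => absurd h hU⟩
  choose t ht using h1
  -- One y ∈ V realizes all the conjugators t U modulo C(U), reducing to equal preimages.
  obtain ⟨y, hyV, hy⟩ := exists_mem_of_components t fun U hU => (ht U hU).1
  have hH' : cj y H ⊔ V = ⊤ := by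
    rw [← cj_of_normal y V, ← cj_sup, hHV]
    exact cj_eq_of_mem (mem_top y)
  obtain ⟨w, hw⟩ := subgroupsConj_iff.1
    (carter_conj_of_autPreimage_eq hV hc (hH.conjugate y) hK hH' fun U hU => by
      conv_lhs => rw [← hU.cj_of_mem hyV]
      rw [← cj_autPreimage, (ht U hU).2, ← mul_inv_cancel_left (t U) y, cj_mul,
        cj_eq_of_mem (centralizer_le_autPreimage H U (hy U hU))])
  exact subgroupsConj_iff.2 ⟨w * y, by rw [cj_mul, hw]⟩

/-- Carter subgroups are conjugate in a finite group with a normal subgroup `N` satisfying the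
relative form of `(*)` and with solvable quotient. -/
theorem carterSubgroupsConj_of_starRel (G : Type*) [Group G] [Finite G] (N : Subgroup G)
    [hNn : N.Normal] (hs : Group.IsSolvable (G ⧸ N)) (hN : StarRel G N) :
    CarterSubgroupsConj G := by
  induction hn : Nat.card G using Nat.strong_induction_on generalizing G with
  | _ n ih =>
  subst hn
  by_cases hb : N = ⊥
  · have : Group.IsSolvable G := by
      refine (Group.isSolvable_iff_subgroup_quotient N).2 ⟨?_, hs⟩
      rw [hb]; infer_instance
    exact carterSubgroupsConj_of_isSolvable G
  obtain ⟨V, hVN, hV⟩ := exists_isMinNormalizedBy_le (L := ⊤) hb le_normalizer_of_normal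
  have hVn := hV.normal
  have hsup : ∀ X : Subgroup G, IsCarter X → X ⊔ V ≠ ⊤ → CarterSubgroupsConj ↥(X ⊔ V) := by
    intro X hX hne
    have hst := hN.subgroupOf (Relation.ReflTransGen.single ⟨hVN, le_normalizer_of_normal⟩)
      (le_sup_right : V ≤ X ⊔ V)
    -- In XV the role of N passes to V, with nilpotent quotient XV/V.
    refine ih _ (card_lt_of_ne_top hne) _ (V.subgroupOf (X ⊔ V)) ?_ hst rfl
    have h1 : X.subgroupOf (X ⊔ V) ⊔ V.subgroupOf (X ⊔ V) = ⊤ := by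
      rw [← subgroupOf_sup le_sup_left le_sup_right, subgroupOf_self]
    have := isNilpotent_quotient_of_sup_eq_top
      (isNilpotent_subgroupOf (le_sup_left : X ≤ X ⊔ V) hX.1) h1
    infer_instance
  have hquot : CarterSubgroupsConj (G ⧸ V) := by
    have hsurj := QuotientGroup.mk'_surjective V
    have hNV : (N.map (QuotientGroup.mk' V)).Normal := hNn.map _ hsurj
    have e := QuotientGroup.quotientQuotientEquivQuotient V N hVN
    refine ih _ (card_quotient_lt hV.1) _ (N.map (QuotientGroup.mk' V)) ?_
      (hN.map_of_surjective hsurj (by rwa [QuotientGroup.ker_mk'])) rfl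
    exact Group.isSolvable_of_isSolvable_injective (f := e.toMonoidHom) e.injective
  intro H K hH hK
  rcases carter_conj_or_sup_eq_top V hH hK (hsup H hH) (hsup K hK) hquot with h | ⟨hHV, hKV⟩
  · exact h
  by_cases hc : ∀ a ∈ V, ∀ b ∈ V, a * b = b * a
  · exact carter_conj_of_sup_eq_top_of_comm hV hc hH hK hHV hKV
  · exact carter_conj_of_sup_eq_top hV hc hN hVN hH hK hHV hKV

/-- Carter subgroups of a finite group satisfying `(*)` are conjugate. -/
theorem SatisfiesStar.carterSubgroupsConj {G : Type*} [Group G] [Finite G]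
    (h : SatisfiesStar G) : CarterSubgroupsConj G := by
  have : Subsingleton (G ⧸ (⊤ : Subgroup G)) := QuotientGroup.subsingleton_quotient_top
  exact carterSubgroupsConj_of_starRel G ⊤ inferInstance h.starRel

theorem IsCarter.isSelfNormalizing_of_le {K Y : Subgroup G} (hK : IsCarter K) (hKY : K ≤ Y)
    (hY : SatisfiesStar Y) : IsSelfNormalizing Y := by
  refine le_antisymm (fun y hy => ?_) le_normalizer
  refine hK.mem_of_cj_le hY.carterSubgroupsConj hKY ?_
  rw [← cj_eq_self_iff.2 hy]
  exact cj_mono hKY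

end Main

/-! ### Fusion of central elements of Carter subgroups. -/

theorem lemma5 {G : Type*} [Group G] [Finite G] (K : Subgroup G) (hK : IsCarter K)
    (z : G) (hz1 : z ≠ 1) (hzK : z ∈ centerIn K)
    (hC : SatisfiesStar (Subgroup.centralizer ({z} : Set G))) :
    (∀ Y : Subgroup G, K ≤ Y → SatisfiesStar Y → IsSelfNormalizing Y) ∧
    (∀ w : G, IsConj z w → w ∈ centerIn K → w = z) ∧
    (∀ H : Subgroup G, IsCarter H → ¬ SubgroupsConj K H →
      ∀ w ∈ centerIn H, ¬ IsConj z w) ∧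
    IsSelfNormalizing (Subgroup.centralizer ({z} : Set G)) ∧
    (∀ k : ℤ, z ^ k ≠ z → ¬ IsConj z (z ^ k)) := by
  have hCC := hC.carterSubgroupsConj
  have h2 : ∀ w : G, IsConj z w → w ∈ centerIn K → w = z := by
    intro w hw hwK
    obtain ⟨g, rfl⟩ := isConj_iff.1 hw
    obtain ⟨c, hc, e⟩ := exists_cj_eq_of_mem_centerIn hK hK hzK hCC hwK
    have hgc : cj (g * c) K = K := by rw [cj_mul, ← e, cj_cj_inv]
    -- gc normalizes K, so it lies in K and commutes with z; cancelling c shows that g does too.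
    have h3 := (mem_centerIn.1 hzK).2 _ (hK.mem_of_cj_eq hgc)
    rw [mem_centralizer_singleton_iff] at hc
    rw [mul_inv_eq_iff_eq_mul]
    rw [mul_assoc, hc, ← mul_assoc, ← mul_assoc] at h3
    exact mul_right_cancel h3
  refine ⟨fun Y hKY hY => hK.isSelfNormalizing_of_le hKY hY, h2, ?_,
    hK.isSelfNormalizing_of_le (le_centralizer_of_mem_centerIn hzK) hC, ?_⟩
  · intro H hH hne w hw hconj
    obtain ⟨g, rfl⟩ := isConj_iff.1 hconj
    obtain ⟨c, -, e⟩ := exists_cj_eq_of_mem_centerIn hK hH hzK hCC hw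
    exact hne (subgroupsConj_iff.2 ⟨g * c, by rw [cj_mul, ← e, cj_cj_inv]⟩)
  · exact fun k hk hconj => hk (h2 _ hconj (zpow_mem hzK k))
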